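/- Let $\mathbb{T}=\mathbb{R}/\mathbb{Z}$ with Lebesgue measure of total mass $1$. An arc $I\subseteq\mathbb{T}$ has length $|I|\in(0,1]$ (so $I=\mathbb{T}$ is allowed), and $\langle u\rangle_I=|I|^{-1}\int_I u$. For $r\ge 0$ put $\Psi_r(t)=t/\log^r(t+e)$ for $t\ge 0$, let $\Psi_r^{-1}(s)=\inf\{t\ge 0:\Psi_r(t)\ge s\}$ (the usual inverse function whenever $\Psi_r$ is increasing), and let $\rho_r(t)=t^{-1}/\Psi_r^{-1}(t^{-1})$ for $t>0$. Denote by $BMO(\rho_r)(\mathbb{T})$ the set of complex-valued $u\in L^2(\mathbb{T})$ such that $$\sup_{I}\frac{1}{\rho_r(|I|)^2|I|}\int_I|u-\langle u\rangle_I|^2<\infty,$$ the supremum being over all arcs $I$, and set $$\|u\|_{BMO^+(\rho_r)}=\Big|\int_{\mathbb{T}}u\Big|+\Big(\sup_{I}\frac{1}{\rho_r(|I|)^2|I|}\int_I|u-\langle u\rangle_I|^2\Big)^{1/2}.$$ Let $K_n(\theta)=\sum_{|j|\le n}\big(1-\frac{|j|}{n+1}\big)e^{2\pi i j\theta}$ be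 the Fejér kernel and $V_m=2K_{2m+1}-K_m$ the de la Vallée Poussin kernel. Put $\delta_0=V_1$, $\delta_n=V_{2^n}-V_{2^{n-1}}$ for $n\ge 1$, and $\Delta_n u=\delta_n*u$ for $n\geq 0$. **Theorem.** Let $r\ge 0$. (a) For every $u\in L^2(\mathbb{T})$, one has $u\in BMO(\rho_r)(\mathbb{T})$ if and only if $$\sup_{I}\frac{1}{\rho_r(|I|)^2|I|}\int_I\sum_{n\ge 0,\ 2^n>|I|^{-1}}|\Delta_n u|^2<\infty .$$ (b) For $u\in L^2(\mathbb{T})$ let $$\|u\|_{r,*}=\Big(\sup_{I}\frac{1}{\rho_r(|I|)^2|I|}\int_I\sum_{n\ge 0,\ 2^n\ge|I|^{-1}}|\Delta_n u|^2\Big)^{1/2}\in[0,\infty].$$ There is a constant $C>0$ depending only on $r$ such that, for all $u\in L^2(\mathbb{T})$, as an inequality in $[0,\infty]$, $$C^{-1}\,\|u\|_{BMO^+(\rho_r)}\le\Big|\int_{\mathbb{T}}u\Big|+\|u\|_{r,*}\le C\,\|u\|_{BMO^+(\rho_r)} .$$ -/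

import Mathlib

open MeasureTheory Filter Topology
open scoped ENNReal NNReal

noncomputable section

namespace LPBMO

/-- The growth function `Ψ_{r,1}(t) = t / log^r (t + e)`, used for `t ≥ 0`. -/
def psi (r t : ℝ) : ℝ := t / (Real.log (t + Real.exp 1)) ^ r

/-- The inverse of `Ψ_{r,1}` on `[0, ∞)`, written as `s ↦ inf {t ≥ 0 : Ψ_{r,1}(t) ≥ s}`.
It is the two-sided inverse whenever `Ψ_{r,1}` is increasing (`psiInv_psi`), and for every `r ≥ 0`
it satisfies `Ψ_{r,1}(psiInv r s) = s` (`psi_psiInv`). -/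
def psiInv (r s : ℝ) : ℝ := sInf {t : ℝ | 0 ≤ t ∧ s ≤ psi r t}

/-- `ρ(t) = t⁻¹ / Ψ⁻¹(t⁻¹)` for `Ψ = Ψ_{r,1}`, used for `t > 0`. -/
def rho (r t : ℝ) : ℝ := t⁻¹ / psiInv r t⁻¹

/-- The arc of the circle `ℝ/ℤ` that starts at `a` and has length `ℓ`, for `0 < ℓ ≤ 1`. -/
def arc (a ℓ : ℝ) : Set UnitAddCircle := (fun x : ℝ => (x : UnitAddCircle)) '' Set.Ioc a (a + ℓ)

/-- The Fejér kernel of order `n`. -/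
def fejer (n : ℕ) (x : UnitAddCircle) : ℂ :=
  ∑ j ∈ Finset.Icc (-(n : ℤ)) (n : ℤ), (1 - ((|j| : ℤ) : ℂ) / ((n : ℂ) + 1)) * fourier j x

/-- The de la Vallée Poussin kernel `V_m = 2 K_{2m+1} - K_m`. -/
def valleePoussin (m : ℕ) (x : UnitAddCircle) : ℂ := 2 * fejer (2 * m + 1) x - fejer m x

/-- `δ_0 = V_1` and `δ_n = V_{2^n} - V_{2^(n-1)}` for `n ≥ 1`. -/
def deltaKernel : ℕ → UnitAddCircle → ℂ
  | 0 => valleePoussin 1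
  | n + 1 => fun x => valleePoussin (2 ^ (n + 1)) x - valleePoussin (2 ^ n) x

/-- The Littlewood--Paley projection `Δ_n u = δ_n ∗ u`. -/
def lpProj (n : ℕ) (u : UnitAddCircle → ℂ) : UnitAddCircle → ℂ :=
  convolution (deltaKernel n) u (ContinuousLinearMap.mul ℂ ℂ) volume

/-- `sup_I (ρ(|I|)² |I|)⁻¹ ∫_I |u - ⟨u⟩_I|²`, the supremum over all arcs `I` of the circle. -/
def oscSup (r : ℝ) (u : UnitAddCircle → ℂ) : ℝ≥0∞ :=
  ⨆ (a : ℝ) (ℓ : ℝ) (_ : 0 < ℓ ∧ ℓ ≤ 1),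
    (ENNReal.ofReal (rho r ℓ ^ 2 * ℓ))⁻¹ *
      ∫⁻ x in arc a ℓ, ‖u x - ⨍ y in arc a ℓ, u y‖ₑ ^ 2

/-- `u` belongs to `BMO(ρ)(𝕋)` for `ρ = ρ_{Ψ_{r,1}}`. -/
def MemBMO (r : ℝ) (u : UnitAddCircle → ℂ) : Prop :=
  MemLp u 2 (volume : Measure UnitAddCircle) ∧ oscSup r u < ∞

/-- The norm `‖u‖_{BMO⁺(ρ)}`: the modulus of the mean of `u` plus the `BMO(ρ)` seminorm. -/
def bmoPlusNorm (r : ℝ) (u : UnitAddCircle → ℂ) : ℝ≥0∞ :=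
  ‖∫ x, u x‖ₑ + oscSup r u ^ (1 / 2 : ℝ)

/-- `sup_I (ρ(|I|)² |I|)⁻¹ ∫_I ∑_{n ≥ 0, 2^n > |I|⁻¹} |Δ_n u|²`, over all arcs `I`. -/
def squareSup (r : ℝ) (u : UnitAddCircle → ℂ) : ℝ≥0∞ :=
  ⨆ (a : ℝ) (ℓ : ℝ) (_ : 0 < ℓ ∧ ℓ ≤ 1),
    (ENNReal.ofReal (rho r ℓ ^ 2 * ℓ))⁻¹ *
      ∫⁻ x in arc a ℓ, ∑' n : {n : ℕ // ℓ⁻¹ < (2 : ℝ) ^ n}, ‖lpProj n u x‖ₑ ^ 2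

/-- `sup_I (ρ(|I|)² |I|)⁻¹ ∫_I ∑_{n ≥ 0, 2^n ≥ |I|⁻¹} |Δ_n u|²`, over all arcs `I`.
This differs from `squareSup` only in that `2^n = |I|⁻¹` is admitted, so that the whole circle
`|I| = 1` also sees `Δ_0 u`. -/
def squareSupClosed (r : ℝ) (u : UnitAddCircle → ℂ) : ℝ≥0∞ :=
  ⨆ (a : ℝ) (ℓ : ℝ) (_ : 0 < ℓ ∧ ℓ ≤ 1),
    (ENNReal.ofReal (rho r ℓ ^ 2 * ℓ))⁻¹ *
      ∫⁻ x in arc a ℓ, ∑' n : {n : ℕ // ℓ⁻¹ ≤ (2 : ℝ) ^ n}, ‖lpProj n u x‖ₑ ^ 2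

/-- The Littlewood--Paley seminorm `‖u‖_{Ψ_{r,1},∗}`, with the sum over `2^n ≥ |I|⁻¹`. -/
def squareSeminorm (r : ℝ) (u : UnitAddCircle → ℂ) : ℝ≥0∞ := squareSupClosed r u ^ (1 / 2 : ℝ)

theorem psiInv_psi {r : ℝ} (h : StrictMonoOn (psi r) (Set.Ici 0)) {t : ℝ} (ht : 0 ≤ t) :
    psiInv r (psi r t) = t := by
  apply IsLeast.csInf_eq
  refine ⟨⟨ht, le_rfl⟩, fun x hx => ?_⟩
  exact (h.le_iff_le ht hx.1).1 hx.2

theorem psi_psiInv {r : ℝ} {s : ℝ} (hs : 0 ≤ s) : psi r (psiInv r s) = s := by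
  have hpos : ∀ t : ℝ, 0 ≤ t → 1 ≤ Real.log (t + Real.exp 1) := fun t ht => by
    rw [Real.le_log_iff_exp_le (by positivity)]; linarith
  have hcont : ContinuousOn (psi r) (Set.Ici 0) := by
    refine continuousOn_id.div ?_ ?_
    · refine ContinuousOn.rpow_const (ContinuousOn.log (by fun_prop) ?_) ?_
      · intro x hx
        have : (0 : ℝ) ≤ x := hx
        positivity
      · intro x hx
        have := hpos x hx
        left; linarith
    · intro x hx
      have := hpos x hx
      have : 0 < Real.log (x + Real.exp 1) := by linarith
      positivity
  have htop : Tendsto (psi r) atTop atTop := by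
    have h1 := (isLittleO_log_rpow_rpow_atTop r (s := 1) one_pos)
    have h2 : Tendsto (fun t : ℝ => t + Real.exp 1) atTop atTop :=
      tendsto_atTop_add_const_right _ _ tendsto_id
    have h3 := (h1.comp_tendsto h2).tendsto_div_nhds_zero
    have h4 : Tendsto (fun t : ℝ => (t + Real.exp 1) / Real.log (t + Real.exp 1) ^ r)
        atTop atTop := by
      have h5 : Tendsto (fun t : ℝ => Real.log (t + Real.exp 1) ^ r / (t + Real.exp 1))
          atTop (𝓝[>] 0) := by
        refine tendsto_nhdsWithin_iff.2 ⟨by simpa [Function.comp_def] using h3, ?_⟩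
        filter_upwards [eventually_ge_atTop 0] with t ht
        have := hpos t ht
        have : 0 < Real.log (t + Real.exp 1) := by linarith
        have : 0 < t + Real.exp 1 := by positivity
        simp only [Set.mem_Ioi]; positivity
      refine h5.inv_tendsto_nhdsGT_zero.congr fun t => ?_
      simp
    refine tendsto_atTop_mono' _ ?_ (h4.const_mul_atTop (show (0 : ℝ) < 1 / 2 by norm_num))
    filter_upwards [eventually_ge_atTop (Real.exp 1)] with t ht
    have h0 : 0 < Real.exp 1 := Real.exp_pos 1
    have := hpos t (by linarith)
    have : 0 < Real.log (t + Real.exp 1) ^ r := by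
      have : 0 < Real.log (t + Real.exp 1) := by linarith
      positivity
    rw [psi, ← mul_div_assoc]
    gcongr
    linarith
  set S : Set ℝ := {t : ℝ | 0 ≤ t ∧ s ≤ psi r t} with hS
  have hne : S.Nonempty := by
    obtain ⟨t, h1, h2⟩ := ((htop.eventually_ge_atTop s).and (eventually_ge_atTop 0)).exists
    exact ⟨t, h2, h1⟩
  have hbd : BddBelow S := ⟨0, fun t ht => ht.1⟩
  have hcl : IsClosed S := by
    have := hcont.preimage_isClosed_of_isClosed isClosed_Ici (isClosed_Ici (a := s))
    exact this
  have hmem : psiInv r s ∈ S := hcl.csInf_mem hne hbd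
  refine le_antisymm ?_ hmem.2
  by_contra! hlt
  have hivt := intermediate_value_Icc hmem.1 (hcont.mono fun x hx => hx.1)
  obtain ⟨x, hx, hxs⟩ := hivt ⟨by simpa [psi] using hs, hlt.le⟩
  have h1 : psiInv r s ≤ x := csInf_le hbd ⟨hx.1, hxs.ge⟩
  have h2 : x = psiInv r s := le_antisymm hx.2 h1
  rw [h2] at hxs
  exact absurd hxs hlt.ne'

end LPBMO

end

noncomputable section

namespace LPBMO

/-! The theorem is a Carleson-type description of a generalised BMO space. The only property of
`rho` that enters the comparison of the two sides, besides positivity, is the slow growth `ρ(t) ≤ A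
(t/s)^{1/4} ρ(s)` for `s ≤ t` (`exists_rho_le`).

Oscillation controls the square function (`exists_squareSupClosed_le`). Fix an arc `I` starting at
`a`, of length `ℓ`, and subtract the mean over `I`, which `Δ_n` annihilates for `n ≥ 1`. Cut the
result into a near part (within `2ℓ` of `a`) and a far part. The near part is handled by the `L²`
bound for the square function, since the multipliers of the `Δ_n` are nonnegative and telescope. On
the far part the kernel of `Δ_n` decays like `2^{-n}|x|^{-2}`, which beats the growth of the
oscillation over the translates `I + jℓ` and leaves a factor `(2^n ℓ)^{-1}`, square summable over
`2^n ≥ ℓ⁻¹`. The piece `Δ_0` matters only for `ℓ = 1`; it sees the mean of `u`, which is why the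
mean appears in the bound.

The square function controls oscillation (`exists_oscSup_le`). Split `u` at frequency `ℓ⁻¹`. A low
piece `Δ_n u` is bounded pointwise by `ρ(2^{-n})` times the seminorm, by reproducing it with a de la
Vallée Poussin kernel; Bernstein's inequality then bounds its variation over `I`, and the sum over
low `n` is geometric (`enorm_low_sub_le`). For the high pieces, multiply by an exponential sum that
is large on `I`, decays off `I`, and has frequencies at most about `ℓ⁻¹`. The products remain almost
orthogonal, so Parseval gives a localised `L²` bound (`lintegral_high_le`).

Part (a) also compares the sums over `2^n > ℓ⁻¹` and `2^n ≥ ℓ⁻¹`: doubling the arc absorbs the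
boundary index, and the remaining `Δ_0` is finite because `u` is in `L²`. -/

/-! ### Arcs of the circle and coverings by translates -/

/-- The coordinate in `(a, a + 1]` makes an arc an interval even when it passes through `0`;
measurability and length follow from this chart. -/
theorem mem_arc_iff {a ℓ : ℝ} (hℓ : ℓ ≤ 1) (x : UnitAddCircle) :
    x ∈ arc a ℓ ↔ (AddCircle.equivIoc 1 a x : ℝ) ≤ a + ℓ := by
  constructor
  · rintro ⟨y, hy, rfl⟩
    have : (AddCircle.equivIoc 1 a (y : UnitAddCircle) : ℝ) = y :=
      AddCircle.equivIoc_coe_of_mem ⟨hy.1, hy.2.trans (by linarith)⟩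
    rw [this]; exact hy.2
  · intro h
    exact ⟨AddCircle.equivIoc 1 a x, ⟨(AddCircle.equivIoc 1 a x).2.1, h⟩,
      AddCircle.coe_equivIoc⟩

theorem measurableSet_arc (a : ℝ) {ℓ : ℝ} (hℓ : ℓ ≤ 1) : MeasurableSet (arc a ℓ) := by
  have : arc a ℓ = {x | (AddCircle.equivIoc 1 a x : ℝ) ≤ a + ℓ} := Set.ext (mem_arc_iff hℓ)
  rw [this]
  exact measurableSet_le
    (measurable_subtype_coe.comp (AddCircle.measurableEquivIoc 1 a).measurable) measurable_const

theorem volume_arc (a : ℝ) {ℓ : ℝ} (h1 : ℓ ≤ 1) :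
    volume (arc a ℓ) = ENNReal.ofReal ℓ := by
  rw [← (AddCircle.measurePreserving_mk 1 a).measure_preimage
    (measurableSet_arc a h1).nullMeasurableSet, Measure.restrict_apply
      ((AddCircle.measurePreserving_mk 1 a).measurable (measurableSet_arc a h1))]
  have : QuotientAddGroup.mk ⁻¹' arc a ℓ ∩ Set.Ioc a (a + 1) = Set.Ioc a (a + ℓ) := by
    ext y
    constructor
    · rintro ⟨h, hy⟩
      have h2 := (mem_arc_iff h1 _).1 h
      have h3 : (AddCircle.equivIoc 1 a (y : UnitAddCircle) : ℝ) = y :=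
        AddCircle.equivIoc_coe_of_mem hy
      refine ⟨hy.1, ?_⟩
      rw [← h3]; exact h2
    · intro hy
      exact ⟨⟨y, hy, rfl⟩, hy.1, hy.2.trans (by linarith)⟩
  rw [this, Real.volume_Ioc]
  congr 1; ring

theorem arc_one (a : ℝ) : arc a 1 = Set.univ := by
  ext x
  simpa [mem_arc_iff le_rfl] using (AddCircle.equivIoc 1 a x).2.2

theorem arc_subset_arc {a b ℓ m : ℝ} (h1 : b ≤ a) (h2 : a + ℓ ≤ b + m) : arc a ℓ ⊆ arc b m :=
  Set.image_mono (Set.Ioc_subset_Ioc h1 h2)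

theorem norm_sub_le_of_mem_arc {a ℓ : ℝ} {x : UnitAddCircle} (hx : x ∈ arc a ℓ) :
    ‖x - (a : UnitAddCircle)‖ ≤ ℓ := by
  obtain ⟨y, hy, rfl⟩ := hx
  have h : ‖((y - a : ℝ) : UnitAddCircle)‖ ≤ ‖y - a‖ := QuotientAddGroup.norm_mk_le_norm
  rw [Real.norm_eq_abs, abs_of_nonneg (by linarith [hy.1])] at h
  simp only [AddCircle.coe_sub] at h
  linarith [hy.2]

theorem exists_real_rep (x : UnitAddCircle) : ∃ z : ℝ, (z : UnitAddCircle) = x ∧ |z| = ‖x‖ := by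
  obtain ⟨y, rfl⟩ := QuotientAddGroup.mk_surjective x
  refine ⟨y - round y, ?_, ?_⟩
  · have : ((round y : ℝ) : UnitAddCircle) = 0 := by
      rw [AddCircle.coe_eq_zero_iff]
      exact ⟨round y, by simp⟩
    rw [AddCircle.coe_sub, this, sub_zero]
  · exact UnitAddCircle.norm_eq.symm

/-- The bound on `j` comes from using the representative of `x - a` of least absolute value. It lets
decay in the distance to `a` be converted into decay in `j`. -/
theorem exists_mem_arc (a : ℝ) {ℓ : ℝ} (h0 : 0 < ℓ) (x : UnitAddCircle) :
    ∃ j : ℤ, x ∈ arc (a + j * ℓ) ℓ ∧ |(j : ℝ)| ≤ 1 + ‖x - (a : UnitAddCircle)‖ / ℓ := by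
  obtain ⟨z, hz, hz'⟩ := exists_real_rep (x - (a : UnitAddCircle))
  rw [← hz']
  have h1 := Int.le_ceil (z / ℓ)
  have h2 := Int.ceil_lt_add_one (z / ℓ)
  refine ⟨⌈z / ℓ⌉ - 1, ⟨a + z, ⟨?_, ?_⟩, ?_⟩, ?_⟩
  · rw [← sub_lt_iff_lt_add, lt_div_iff₀ h0] at h2
    push_cast; linarith
  · rw [div_le_iff₀ h0] at h1
    push_cast; linarith
  · simp [hz]
  · have h3 : |z / ℓ| = |z| / ℓ := by rw [abs_div, abs_of_pos h0]
    rw [← h3]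
    push_cast
    have h4 := neg_abs_le (z / ℓ)
    have h5 := le_abs_self (z / ℓ)
    rw [abs_le]; constructor <;> linarith

/-- Domination by translates of an arc: a weighted integral over the circle is controlled by the
integrals over the arcs `arc (a + j * ℓ) ℓ`. -/
theorem lintegral_le_tsum_arc (a : ℝ) {ℓ : ℝ} (h0 : 0 < ℓ) (h1 : ℓ ≤ 1)
    (F G : UnitAddCircle → ℝ≥0∞) (w : ℤ → ℝ≥0∞) (hw : ∀ j, w j ≠ ∞)
    (h : ∀ (j : ℤ) (x : UnitAddCircle), x ∈ arc (a + j * ℓ) ℓ →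
      |(j : ℝ)| ≤ 1 + ‖x - (a : UnitAddCircle)‖ / ℓ → F x ≤ w j * G x) :
    ∫⁻ x, F x ≤ ∑' j : ℤ, w j * ∫⁻ x in arc (a + j * ℓ) ℓ, G x := by
  -- The translates wrap around the circle and overlap. Only a covering is needed, and keeping just
  -- the points where `j` is comparable to the distance makes the hypothesis on `F` available.
  set s : ℤ → Set UnitAddCircle := fun j =>
    arc (a + j * ℓ) ℓ ∩ {x | |(j : ℝ)| ≤ 1 + ‖x - (a : UnitAddCircle)‖ / ℓ}
  have hs : (⋃ j, s j) = Set.univ := by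
    refine Set.eq_univ_of_forall fun x => ?_
    obtain ⟨j, hj⟩ := exists_mem_arc a h0 x
    exact Set.mem_iUnion.2 ⟨j, hj⟩
  have hms : ∀ j, MeasurableSet (s j) := fun j =>
    (measurableSet_arc _ h1).inter (measurableSet_le measurable_const (by fun_prop))
  rw [← setLIntegral_univ, ← hs]
  refine (lintegral_iUnion_le _ _).trans (ENNReal.tsum_le_tsum fun j => ?_)
  rw [← lintegral_const_mul' _ _ (hw j)]
  exact (setLIntegral_mono' (hms j) fun x hx => h j x hx.1 hx.2).trans
    (lintegral_mono_set Set.inter_subset_left)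

/-! ### Cauchy–Schwarz and means over arcs -/

theorem sq_setLIntegral_le {α : Type*} [MeasurableSpace α] {μ : Measure α} {s : Set α}
    {F : α → ℝ≥0∞} (hF : AEMeasurable F μ) :
    (∫⁻ x in s, F x ∂μ) ^ 2 ≤ μ s * ∫⁻ x in s, F x ^ 2 ∂μ := by
  have h := ENNReal.lintegral_mul_le_Lp_mul_Lq (μ.restrict s) Real.HolderConjugate.two_two
    (f := fun _ => 1) (g := F) aemeasurable_const hF.restrict
  have h2 : (∫⁻ x in s, F x ∂μ) ≤ (μ s) ^ (1 / 2 : ℝ) * (∫⁻ x in s, F x ^ 2 ∂μ) ^ (1 / 2 : ℝ) := by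
    simpa using h
  calc (∫⁻ x in s, F x ∂μ) ^ 2
      ≤ ((μ s) ^ (1 / 2 : ℝ) * (∫⁻ x in s, F x ^ 2 ∂μ) ^ (1 / 2 : ℝ)) ^ 2 := by gcongr
    _ = _ := by
      rw [mul_pow, ← ENNReal.rpow_natCast, ← ENNReal.rpow_natCast, ← ENNReal.rpow_mul,
        ← ENNReal.rpow_mul]
      norm_num

theorem setLIntegral_arc_le_of_sq {a ℓ : ℝ} (h1 : ℓ ≤ 1) {F : UnitAddCircle → ℝ≥0∞}
    (hF : AEMeasurable F) {m : ℝ≥0∞}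
    (h : ∫⁻ x in arc a ℓ, F x ^ 2 ≤ ENNReal.ofReal ℓ * m ^ 2) :
    ∫⁻ x in arc a ℓ, F x ≤ ENNReal.ofReal ℓ * m := by
  have h2 := (sq_setLIntegral_le (s := arc a ℓ) hF).trans
    (mul_le_mul_right h _)
  rw [volume_arc a h1, ← mul_assoc, ← sq, ← mul_pow] at h2
  exact (ENNReal.pow_le_pow_left_iff two_ne_zero).1 h2

theorem integrable_of_memLp_two {u : UnitAddCircle → ℂ} (hu : MemLp u 2) : Integrable u :=
  hu.integrable one_le_two

/-- The mean over an arc is the best constant up to a factor. -/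
theorem enorm_setAverage_sub_sq_le {a ℓ : ℝ} (h0 : 0 < ℓ) (h1 : ℓ ≤ 1) {u : UnitAddCircle → ℂ}
    (hu : MemLp u 2) (c : ℂ) :
    ENNReal.ofReal ℓ * ‖(⨍ y in arc a ℓ, u y) - c‖ₑ ^ 2 ≤ ∫⁻ x in arc a ℓ, ‖u x - c‖ₑ ^ 2 := by
  have hv : volume.real (arc a ℓ) = ℓ := by
    rw [measureReal_def, volume_arc a h1, ENNReal.toReal_ofReal h0.le]
  have hi : Integrable u := integrable_of_memLp_two hu
  have h2 : (ℓ : ℂ) * ((⨍ y in arc a ℓ, u y) - c) = ∫ y in arc a ℓ, (u y - c) := by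
    rw [integral_sub hi.integrableOn (integrable_const c), setAverage_eq, setIntegral_const, hv]
    have : (ℓ : ℂ) ≠ 0 := by exact_mod_cast h0.ne'
    simp only [Complex.real_smul]
    push_cast
    field_simp
  have h3 : ENNReal.ofReal ℓ * ‖(⨍ y in arc a ℓ, u y) - c‖ₑ ≤ ∫⁻ x in arc a ℓ, ‖u x - c‖ₑ := by
    have h4 := enorm_integral_le_lintegral_enorm (μ := volume.restrict (arc a ℓ))
      (fun y => u y - c)
    rw [← h2, enorm_mul] at h4
    refine le_trans (le_of_eq ?_) h4
    congr 1
    rw [← ofReal_norm]; simp [abs_of_pos h0]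
  have h5 : AEMeasurable (fun x => ‖u x - c‖ₑ) :=
    (hu.aestronglyMeasurable.sub aestronglyMeasurable_const).enorm
  have h6 := (pow_le_pow_left' h3 2).trans (sq_setLIntegral_le h5)
  have hne : ENNReal.ofReal ℓ ≠ 0 := by simpa using h0
  rw [volume_arc a h1, mul_pow, sq (ENNReal.ofReal ℓ), mul_assoc] at h6
  exact (ENNReal.mul_le_mul_iff_right hne ENNReal.ofReal_ne_top).1 h6

theorem ennreal_add_sq_le (x y : ℝ≥0∞) : (x + y) ^ 2 ≤ 2 * (x ^ 2 + y ^ 2) := by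
  induction x with
  | top => simp
  | coe x =>
    induction y with
    | top => simp
    | coe y =>
      have h : (x + y) ^ 2 ≤ 2 * (x ^ 2 + y ^ 2) := by
        have := two_mul_le_add_sq x y
        nlinarith
      exact_mod_cast h

theorem enorm_add_sq_le (z w : ℂ) : ‖z + w‖ₑ ^ 2 ≤ 2 * (‖z‖ₑ ^ 2 + ‖w‖ₑ ^ 2) :=
  (pow_le_pow_left' (enorm_add_le z w) 2).trans (ennreal_add_sq_le _ _)

theorem setLIntegral_enorm_add_sq_le {s : Set UnitAddCircle} {f g : UnitAddCircle → ℂ}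
    (hf : AEMeasurable f) :
    ∫⁻ x in s, ‖f x + g x‖ₑ ^ 2 ≤
      2 * (∫⁻ x in s, ‖f x‖ₑ ^ 2) + 2 * ∫⁻ x in s, ‖g x‖ₑ ^ 2 := by
  rw [← mul_add, ← lintegral_add_left' ((hf.enorm.pow_const 2).restrict),
    ← lintegral_const_mul' _ _ (by simp)]
  exact lintegral_mono fun x => enorm_add_sq_le _ _

/-- Oscillation may be measured from any constant, which later is the value at `a` of the
low-frequency part. The factor is `2 + 2`: once for `u - c`, once for the distance from `c` to the
mean. -/
theorem setLIntegral_sub_setAverage_le {a ℓ : ℝ} (h0 : 0 < ℓ) (h1 : ℓ ≤ 1)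
    {u : UnitAddCircle → ℂ} (hu : MemLp u 2) (c : ℂ) :
    ∫⁻ x in arc a ℓ, ‖u x - ⨍ y in arc a ℓ, u y‖ₑ ^ 2 ≤ 4 * ∫⁻ x in arc a ℓ, ‖u x - c‖ₑ ^ 2 := by
  have h := setLIntegral_enorm_add_sq_le (s := arc a ℓ) (f := fun x => u x - c)
    (g := fun _ => c - ⨍ y in arc a ℓ, u y)
    (hu.aestronglyMeasurable.sub aestronglyMeasurable_const).aemeasurable
  simp only [sub_add_sub_cancel, lintegral_const, Measure.restrict_apply_univ, volume_arc a h1] at h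
  refine h.trans ?_
  have h2 := enorm_setAverage_sub_sq_le (a := a) h0 h1 hu c
  rw [← enorm_neg, neg_sub, mul_comm] at h2
  calc _ ≤ 2 * (∫⁻ x in arc a ℓ, ‖u x - c‖ₑ ^ 2) + 2 * (∫⁻ x in arc a ℓ, ‖u x - c‖ₑ ^ 2) := by
        gcongr
    _ = _ := by ring

/-! ### Summable weights, Parseval and trigonometric sums -/

theorem summable_one_add_abs_rpow {p : ℝ} (hp : 1 < p) :
    Summable fun j : ℤ => (1 + |(j : ℝ)|) ^ (-p) := by
  have h : Summable fun n : ℕ => (1 + (n : ℝ)) ^ (-p) := by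
    have := (summable_nat_add_iff 1).2 (Real.summable_nat_rpow.2 (neg_lt_neg hp))
    refine this.congr fun n => ?_
    push_cast; rw [add_comm]
  refine Summable.of_nat_of_neg ?_ ?_ <;> simpa using h

/-- The total mass of the weights `(1 + |j|)^{-p}`. -/
def weightSum (p : ℝ) : ℝ≥0∞ := ∑' j : ℤ, ENNReal.ofReal ((1 + |(j : ℝ)|) ^ (-p))

theorem weightSum_lt_top {p : ℝ} (hp : 1 < p) : weightSum p < ∞ :=
  lt_top_iff_ne_top.2 (summable_one_add_abs_rpow hp).tsum_ofReal_ne_top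

theorem volume_eq_haarAddCircle :
    (volume : Measure UnitAddCircle) = AddCircle.haarAddCircle := by
  rw [AddCircle.volume_eq_smul_haarAddCircle]; simp

theorem fourierCoeff_eq_integral (f : UnitAddCircle → ℂ) (k : ℤ) :
    fourierCoeff f k = ∫ t, fourier (-k) t * f t := by
  rw [fourierCoeff, volume_eq_haarAddCircle]; rfl

/-- Parseval's identity with values in `[0, ∞]`. -/
theorem tsum_enorm_fourierCoeff_sq {f : UnitAddCircle → ℂ} (hf : MemLp f 2) :
    ∑' k : ℤ, ‖fourierCoeff f k‖ₑ ^ 2 = ∫⁻ x, ‖f x‖ₑ ^ 2 := by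
  rw [volume_eq_haarAddCircle] at hf ⊢
  have hae := hf.coeFn_toLp
  have h := hasSum_sq_fourierCoeff (hf.toLp f)
  have hc : ∀ k, fourierCoeff (hf.toLp f) k = fourierCoeff f k := fun k => by
    exact congrFun (fourierCoeff_congr_ae hae) k
  simp only [hc] at h
  have hi : ∫ t, ‖hf.toLp f t‖ ^ 2 ∂AddCircle.haarAddCircle
      = ∫ t, ‖f t‖ ^ 2 ∂AddCircle.haarAddCircle :=
    integral_congr_ae (hae.mono fun x hx => by simp only [hx])
  rw [hi] at h
  have h1 : ∀ z : ℂ, ‖z‖ₑ ^ 2 = ENNReal.ofReal (‖z‖ ^ 2) := fun z => by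
    rw [← ofReal_norm, ENNReal.ofReal_pow (norm_nonneg _)]
  simp only [h1]
  rw [← ofReal_integral_eq_lintegral_ofReal (hf.integrable_norm_pow two_ne_zero)
    (Eventually.of_forall fun x => by positivity), ← h.tsum_eq,
    ENNReal.ofReal_tsum_of_nonneg (fun k => by positivity) h.summable]

/-- The trigonometric sum with coefficients `c` and frequencies in `s`. -/
def trigPoly (s : Finset ℤ) (c : ℤ → ℂ) (x : UnitAddCircle) : ℂ := ∑ k ∈ s, c k * fourier k x

theorem continuous_trigPoly (s : Finset ℤ) (c : ℤ → ℂ) : Continuous (trigPoly s c) := by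
  unfold trigPoly; fun_prop

theorem memLp_of_continuous {f : UnitAddCircle → ℂ} (hf : Continuous f) (p : ℝ≥0∞) :
    MemLp f p := by
  obtain ⟨C, hC⟩ := (isCompact_range hf).isBounded.exists_norm_le
  exact MemLp.of_bound hf.aestronglyMeasurable C
    (Eventually.of_forall fun x => hC _ (Set.mem_range_self x))

theorem integrable_of_continuous {f : UnitAddCircle → ℂ} (hf : Continuous f) : Integrable f :=
  memLp_one_iff_integrable.1 (memLp_of_continuous hf 1)

theorem integrable_fourier_mul {f : UnitAddCircle → ℂ} (hf : Integrable f) (k : ℤ) :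
    Integrable fun t => fourier k t * f t :=
  hf.bdd_mul (fourier k).continuous.aestronglyMeasurable
    (c := 1) (Eventually.of_forall fun x => by rw [fourier_apply, Circle.norm_coe])

theorem fourierCoeff_trigPoly (s : Finset ℤ) (c : ℤ → ℂ) (k : ℤ) :
    fourierCoeff (trigPoly s c) k = if k ∈ s then c k else 0 := by
  have h : trigPoly s c = ∑ j ∈ s, fun x => c j * fourier j x := by
    ext x; simp [trigPoly]
  rw [h, fourierCoeff.sum]
  · rw [Finset.sum_apply]
    refine (Finset.sum_congr rfl fun j _ => ?_).trans (Finset.sum_ite_eq' s k c)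
    rw [fourierCoeff.const_mul, fourierCoeff_fourier, Pi.single_apply]
    simp [eq_comm]
  · intro j _
    rw [← volume_eq_haarAddCircle]
    exact integrable_of_continuous (by fun_prop)

theorem fourier_mul_integral_sub (f : UnitAddCircle → ℂ) (k : ℤ) (x : UnitAddCircle) :
    ∫ t, fourier k t * f (x - t) = fourierCoeff f k * fourier k x := by
  rw [← integral_sub_left_eq_self (fun t => fourier k t * f (x - t)) volume x,
    fourierCoeff_eq_integral, ← integral_mul_const]
  refine integral_congr_ae (Eventually.of_forall fun t => ?_)
  have : (fourier k (x - t) : ℂ) = fourier k x * fourier (-k) t := by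
    simp only [fourier_apply, sub_eq_add_neg, zsmul_add, AddCircle.toCircle_add, Circle.coe_mul,
      zsmul_neg, neg_zsmul]
  simp only [this, sub_sub_cancel]; ring

theorem integrable_comp_sub_left {f : UnitAddCircle → ℂ} (hf : Integrable f) (x : UnitAddCircle) :
    Integrable fun t => f (x - t) := hf.comp_sub_left x

theorem convolution_trigPoly {f : UnitAddCircle → ℂ} (hf : Integrable f) (s : Finset ℤ)
    (c : ℤ → ℂ) (x : UnitAddCircle) :
    ∫ t, trigPoly s c t * f (x - t) = trigPoly s (fun k => c k * fourierCoeff f k) x := by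
  simp only [trigPoly, Finset.sum_mul]
  rw [integral_finsetSum]
  · refine Finset.sum_congr rfl fun k _ => ?_
    simp only [mul_assoc]
    rw [integral_const_mul, fourier_mul_integral_sub]
  · intro k _
    simp only [mul_assoc]
    exact (integrable_fourier_mul (integrable_comp_sub_left hf x) k).const_mul _

theorem convolution_with_trigPoly {κ : UnitAddCircle → ℂ} (hκ : Integrable κ) (s : Finset ℤ)
    (c : ℤ → ℂ) (x : UnitAddCircle) :
    ∫ t, κ t * trigPoly s c (x - t) = trigPoly s (fun k => c k * fourierCoeff κ k) x := by
  rw [← integral_sub_left_eq_self (fun t => κ t * trigPoly s c (x - t)) volume x]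
  simp only [sub_sub_cancel]
  rw [← integral_congr_ae (Eventually.of_forall fun t => mul_comm _ _),
    convolution_trigPoly hκ]

theorem fourierCoeff_mul_fourier (f : UnitAddCircle → ℂ) (i k : ℤ) :
    fourierCoeff (fun x => f x * fourier i x) k = fourierCoeff f (k - i) := by
  rw [fourierCoeff_eq_integral, fourierCoeff_eq_integral]
  refine integral_congr_ae (Eventually.of_forall fun t => ?_)
  have : (fourier (-(k - i)) t : ℂ) = fourier (-k) t * fourier i t := by
    rw [← fourier_add]; congr 2; ring
  simp only [this]; ring

theorem trigPoly_congr {s : Finset ℤ} {c d : ℤ → ℂ} (h : ∀ k ∈ s, c k = d k) :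
    trigPoly s c = trigPoly s d := by
  ext x; exact Finset.sum_congr rfl fun k hk => by rw [h k hk]

theorem trigPoly_subset {s t : Finset ℤ} {c : ℤ → ℂ} (hst : s ⊆ t)
    (h : ∀ k ∈ t, k ∉ s → c k = 0) : trigPoly s c = trigPoly t c := by
  ext x
  exact Finset.sum_subset hst fun k hk hks => by rw [h k hk hks, zero_mul]

/-! ### Multipliers of the Littlewood–Paley pieces -/

/-- The Fourier multiplier of the Fejér kernel. -/
def fejerMult (n : ℕ) (k : ℤ) : ℝ := max 0 (1 - |(k : ℝ)| / (n + 1))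

/-- The Fourier multiplier of the de la Vallée Poussin kernel. -/
def vpMult (m : ℕ) (k : ℤ) : ℝ := 2 * fejerMult (2 * m + 1) k - fejerMult m k

/-- The Fourier multiplier of `Δ_n`. -/
def lpMult : ℕ → ℤ → ℝ
  | 0 => vpMult 1
  | n + 1 => fun k => vpMult (2 ^ (n + 1)) k - vpMult (2 ^ n) k

theorem fejerMult_of_le {n : ℕ} {k : ℤ} (h : |k| ≤ n) :
    fejerMult n k = 1 - |(k : ℝ)| / (n + 1) := by
  refine max_eq_right ?_
  have : |(k : ℝ)| ≤ n := by exact_mod_cast h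
  rw [sub_nonneg, div_le_one (by positivity)]
  linarith

theorem fejerMult_of_lt {n : ℕ} {k : ℤ} (h : (n : ℤ) < |k|) : fejerMult n k = 0 := by
  refine max_eq_left ?_
  have : (n : ℝ) + 1 ≤ |(k : ℝ)| := by exact_mod_cast h
  rw [sub_nonpos, one_le_div (by positivity)]
  exact this

theorem fejer_eq_trigPoly {n : ℕ} {s : Finset ℤ} (hs : Finset.Icc (-(n : ℤ)) n ⊆ s) :
    fejer n = trigPoly s fun k => (fejerMult n k : ℂ) := by
  rw [← trigPoly_subset hs]
  · ext x
    refine Finset.sum_congr rfl fun k hk => ?_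
    simp only [fejerMult_of_le (abs_le.2 (Finset.mem_Icc.1 hk))]
    have : ((|k| : ℤ) : ℂ) = ((|(k : ℝ)| : ℝ) : ℂ) := by
      rw [← Int.cast_abs, Complex.ofReal_intCast]
    rw [this]; push_cast; rfl
  · intro k _ hk
    rw [fejerMult_of_lt, Complex.ofReal_zero]
    by_contra! h
    exact hk (Finset.mem_Icc.2 (abs_le.1 h))

theorem valleePoussin_eq_trigPoly {m : ℕ} {s : Finset ℤ}
    (hs : Finset.Icc (-(2 * m + 1 : ℤ)) (2 * m + 1) ⊆ s) :
    valleePoussin m = trigPoly s fun k => (vpMult m k : ℂ) := by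
  ext x
  rw [valleePoussin, fejer_eq_trigPoly (s := s) (by exact_mod_cast hs),
    fejer_eq_trigPoly (n := m) (s := s)
      ((Finset.Icc_subset_Icc (by lia) (by lia)).trans hs)]
  simp only [trigPoly, vpMult, Finset.mul_sum, ← Finset.sum_sub_distrib]
  refine Finset.sum_congr rfl fun k _ => ?_
  push_cast; ring

theorem deltaKernel_eq_trigPoly {n : ℕ} {s : Finset ℤ}
    (hs : Finset.Icc (-(2 ^ (n + 1) + 1 : ℤ)) (2 ^ (n + 1) + 1) ⊆ s) :
    deltaKernel n = trigPoly s fun k => (lpMult n k : ℂ) := by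
  cases n with
  | zero => exact valleePoussin_eq_trigPoly (by simpa using hs)
  | succ n =>
    ext x
    have h2 : (1 : ℤ) ≤ 2 ^ n := one_le_pow₀ (by norm_num)
    simp only [deltaKernel]
    rw [valleePoussin_eq_trigPoly (s := s)
        ((Finset.Icc_subset_Icc (by push_cast; lia) (by push_cast; lia)).trans hs),
      valleePoussin_eq_trigPoly (m := 2 ^ n) (s := s)
        ((Finset.Icc_subset_Icc (by push_cast; lia) (by push_cast; lia)).trans hs)]
    simp only [trigPoly, lpMult, ← Finset.sum_sub_distrib]
    refine Finset.sum_congr rfl fun k _ => ?_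
    push_cast; ring

/-- The multiplier is a trapezoid: `1` up to `m + 1`, then linear down to `0` at `2m + 2`. Support,
monotonicity in `m` and the bounds `0` and `1` are read off this form. -/
theorem vpMult_eq (m : ℕ) (k : ℤ) : vpMult m k = max 0 (min 1 (2 - |(k : ℝ)| / (m + 1))) := by
  have hm : (0 : ℝ) < m + 1 := by positivity
  have h2 : |(k : ℝ)| / ((2 * m + 1 : ℕ) + 1) = (|(k : ℝ)| / (m + 1)) / 2 := by
    push_cast; field_simp; ring
  rw [vpMult, fejerMult, fejerMult, h2]
  have : 0 ≤ |(k : ℝ)| / (m + 1) := by positivity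
  generalize |(k : ℝ)| / (m + 1) = y at *
  grind

theorem vpMult_nonneg (m : ℕ) (k : ℤ) : 0 ≤ vpMult m k := by
  rw [vpMult_eq]; exact le_max_left _ _

theorem vpMult_le_one (m : ℕ) (k : ℤ) : vpMult m k ≤ 1 := by
  rw [vpMult_eq]; exact max_le zero_le_one (min_le_left _ _)

theorem vpMult_mono {m n : ℕ} (h : m ≤ n) (k : ℤ) : vpMult m k ≤ vpMult n k := by
  rw [vpMult_eq, vpMult_eq]
  gcongr

theorem vpMult_eq_one {m : ℕ} {k : ℤ} (h : |k| ≤ m + 1) : vpMult m k = 1 := by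
  have h1 : |(k : ℝ)| ≤ m + 1 := by exact_mod_cast h
  have h2 : |(k : ℝ)| / (m + 1) ≤ 1 := (div_le_one (by positivity)).2 h1
  rw [vpMult_eq, min_eq_left (by linarith), max_eq_right zero_le_one]

theorem vpMult_eq_zero {m : ℕ} {k : ℤ} (h : 2 * (m : ℤ) + 2 ≤ |k|) : vpMult m k = 0 := by
  have h1 : 2 * (m : ℝ) + 2 ≤ |(k : ℝ)| := by exact_mod_cast h
  have h2 : 2 ≤ |(k : ℝ)| / (m + 1) := (le_div_iff₀ (by positivity)).2 (by linarith)
  rw [vpMult_eq]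
  exact max_eq_left ((min_le_right _ _).trans (by linarith))

theorem lpMult_nonneg (n : ℕ) (k : ℤ) : 0 ≤ lpMult n k := by
  cases n with
  | zero => exact vpMult_nonneg _ _
  | succ n => exact sub_nonneg.2 (vpMult_mono (Nat.pow_le_pow_right (by norm_num) n.le_succ) k)

theorem sum_lpMult (M : ℕ) (k : ℤ) :
    ∑ n ∈ Finset.range (M + 1), lpMult n k = vpMult (2 ^ M) k := by
  induction M with
  | zero => simp [lpMult]
  | succ M ih => rw [Finset.sum_range_succ, ih]; simp [lpMult]

theorem lpMult_succ_eq_zero {n : ℕ} {k : ℤ} (h : |k| ≤ 2 ^ n + 1) : lpMult (n + 1) k = 0 := by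
  have : (2 : ℤ) ^ n ≤ 2 ^ (n + 1) := pow_le_pow_right₀ (by norm_num) n.le_succ
  simp only [lpMult]
  rw [vpMult_eq_one (by push_cast; linarith), vpMult_eq_one (by push_cast; linarith), sub_self]

theorem lpMult_eq_zero {n : ℕ} {k : ℤ} (h : 2 ^ (n + 1) + 1 < |k|) : lpMult n k = 0 := by
  cases n with
  | zero => exact vpMult_eq_zero (by simp at h ⊢; lia)
  | succ n =>
    have : (2 : ℤ) ^ (n + 1) = 2 * 2 ^ n := by ring
    have : (2 : ℤ) ^ (n + 2) = 4 * 2 ^ n := by ring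
    have : (0 : ℤ) < 2 ^ n := by positivity
    simp only [lpMult]
    rw [vpMult_eq_zero (by push_cast; lia), vpMult_eq_zero (by push_cast; lia), sub_self]

/-- The multipliers are nonnegative with telescoping partial sums at most `1`. Each is therefore at
most `1`, and its square is no larger than itself. -/
theorem tsum_lpMult_sq_le (k : ℤ) : ∑' n, ENNReal.ofReal (lpMult n k) ^ 2 ≤ 1 := by
  have h1 : ∀ n, ENNReal.ofReal (lpMult n k) ^ 2 ≤ ENNReal.ofReal (lpMult n k) := fun n => by
    have : lpMult n k ≤ 1 := by
      refine le_trans ?_ (vpMult_le_one (2 ^ n) k)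
      rw [← sum_lpMult]
      exact Finset.single_le_sum (f := fun n => lpMult n k) (fun i _ => lpMult_nonneg i k)
        (Finset.self_mem_range_succ n)
    have h2 : ENNReal.ofReal (lpMult n k) ≤ 1 := by simpa using this
    rw [sq]
    exact mul_le_of_le_one_left' h2
  refine (ENNReal.tsum_le_tsum h1).trans ?_
  rw [ENNReal.tsum_eq_iSup_nat]
  refine iSup_le fun M => ?_
  refine (Finset.sum_le_sum_of_subset (Finset.range_mono M.le_succ)).trans ?_
  rw [← ENNReal.ofReal_sum_of_nonneg fun n _ => lpMult_nonneg n k, sum_lpMult]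
  simpa using vpMult_le_one _ _

theorem lpProj_eq_trigPoly {u : UnitAddCircle → ℂ} (hu : Integrable u) {n : ℕ} {s : Finset ℤ}
    (hs : Finset.Icc (-(2 ^ (n + 1) + 1 : ℤ)) (2 ^ (n + 1) + 1) ⊆ s) :
    lpProj n u = trigPoly s fun k => lpMult n k * fourierCoeff u k := by
  ext x
  rw [← convolution_trigPoly hu, ← deltaKernel_eq_trigPoly hs]
  rfl

theorem continuous_lpProj {u : UnitAddCircle → ℂ} (hu : Integrable u) (n : ℕ) :
    Continuous (lpProj n u) := by
  rw [lpProj_eq_trigPoly hu subset_rfl]; exact continuous_trigPoly _ _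

theorem fourierCoeff_lpProj {u : UnitAddCircle → ℂ} (hu : Integrable u) (n : ℕ) (k : ℤ) :
    fourierCoeff (lpProj n u) k = lpMult n k * fourierCoeff u k := by
  rw [lpProj_eq_trigPoly hu subset_rfl, fourierCoeff_trigPoly]
  split_ifs with h
  · rfl
  · rw [lpMult_eq_zero, Complex.ofReal_zero, zero_mul]
    by_contra! h2
    exact h (Finset.mem_Icc.2 (abs_le.1 h2))

/-- The Littlewood-Paley square function is bounded on `L²`. -/
theorem tsum_lintegral_lpProj_le {u : UnitAddCircle → ℂ} (hu : MemLp u 2) :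
    ∑' n, ∫⁻ x, ‖lpProj n u x‖ₑ ^ 2 ≤ ∫⁻ x, ‖u x‖ₑ ^ 2 := by
  have hi := integrable_of_memLp_two hu
  have h : ∀ n, ∫⁻ x, ‖lpProj n u x‖ₑ ^ 2 =
      ∑' k, ENNReal.ofReal (lpMult n k) ^ 2 * ‖fourierCoeff u k‖ₑ ^ 2 := fun n => by
    rw [← tsum_enorm_fourierCoeff_sq (memLp_of_continuous (continuous_lpProj hi n) 2)]
    refine tsum_congr fun k => ?_
    rw [fourierCoeff_lpProj hi, enorm_mul, mul_pow]
    congr 2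
    rw [← ofReal_norm, Complex.norm_real, Real.norm_of_nonneg (lpMult_nonneg n k)]
  simp only [h]
  rw [ENNReal.tsum_comm, ← tsum_enorm_fourierCoeff_sq hu]
  refine ENNReal.tsum_le_tsum fun k => ?_
  rw [ENNReal.tsum_mul_right]
  exact mul_le_of_le_one_left' (tsum_lpMult_sq_le k)

theorem lpProj_add {f g : UnitAddCircle → ℂ} (hf : Integrable f) (hg : Integrable g) (n : ℕ)
    (x : UnitAddCircle) : lpProj n (fun y => f y + g y) x = lpProj n f x + lpProj n g x := by
  have hfg : Integrable fun y => f y + g y := hf.add hg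
  rw [lpProj_eq_trigPoly hf subset_rfl, lpProj_eq_trigPoly hg subset_rfl,
    lpProj_eq_trigPoly hfg subset_rfl, trigPoly, trigPoly, trigPoly,
    ← Finset.sum_add_distrib]
  refine Finset.sum_congr rfl fun k _ => ?_
  have := congrFun (fourierCoeff.add (volume_eq_haarAddCircle ▸ hf)
    (volume_eq_haarAddCircle ▸ hg)) k
  simp only [Pi.add_apply] at this
  have h2 : fourierCoeff (fun y => f y + g y) k = fourierCoeff f k + fourierCoeff g k := this
  rw [h2]; ring

theorem lpProj_succ_const (c : ℂ) (n : ℕ) (x : UnitAddCircle) :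
    lpProj (n + 1) (fun _ => c) x = 0 := by
  rw [lpProj_eq_trigPoly (integrable_const c) subset_rfl]
  refine Finset.sum_eq_zero fun k _ => ?_
  rcases eq_or_ne k 0 with rfl | hk
  · have : lpMult (n + 1) 0 = 0 := lpMult_succ_eq_zero (by simp; positivity)
    simp [this]
  · have : (fun _ : UnitAddCircle => c) = trigPoly {0} fun _ => c := by
      ext x; simp [trigPoly]
    simp [this, fourierCoeff_trigPoly, hk]

theorem lpProj_succ_sub_const {u : UnitAddCircle → ℂ} (hu : Integrable u) (c : ℂ) (n : ℕ)
    (x : UnitAddCircle) : lpProj (n + 1) (fun y => u y - c) x = lpProj (n + 1) u x := by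
  have := lpProj_add hu (integrable_const (-c)) (n + 1) x
  rw [lpProj_succ_const, add_zero] at this
  simpa only [sub_eq_add_neg] using this

/-- The partial sums of the Littlewood-Paley decomposition converge in `L²`. -/
theorem tendsto_lintegral_sub_sum_lpProj {u : UnitAddCircle → ℂ} (hu : MemLp u 2) :
    Tendsto (fun M => ∫⁻ x, ‖u x - ∑ n ∈ Finset.range (M + 1), lpProj n u x‖ₑ ^ 2) atTop
      (𝓝 0) := by
  have hi := integrable_of_memLp_two hu
  have hP := tsum_enorm_fourierCoeff_sq hu
  have hfin : ∑' k : ℤ, ‖fourierCoeff u k‖ₑ ^ 2 ≠ ∞ := by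
    rw [hP]
    have := (eLpNorm_lt_top_iff_lintegral_rpow_enorm_lt_top (by norm_num) (by norm_num)).1 hu.2
    exact (by simpa using this : ∫⁻ x, ‖u x‖ₑ ^ 2 < ∞).ne
  have ht := ENNReal.tendsto_tsum_compl_atTop_zero hfin
  have hI : Tendsto (fun M : ℕ => Finset.Icc (-(M : ℤ)) M) atTop atTop := by
    refine tendsto_atTop_finset_of_monotone (fun m n h => Finset.Icc_subset_Icc (by lia) (by lia))
      fun k => ⟨k.natAbs, ?_⟩
    rw [Finset.mem_Icc]; lia
  refine tendsto_of_tendsto_of_tendsto_of_le_of_le tendsto_const_nhds (ht.comp hI)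
    (fun _ => zero_le) fun M => ?_
  set P : UnitAddCircle → ℂ := fun x => ∑ n ∈ Finset.range (M + 1), lpProj n u x with hPdef
  have hPc : Continuous P := continuous_finsetSum _ fun n _ => continuous_lpProj hi n
  have hco : ∀ k, fourierCoeff (fun x => u x - P x) k =
      ((1 - vpMult (2 ^ M) k : ℝ) : ℂ) * fourierCoeff u k := fun k => by
    have h1 : fourierCoeff P k = vpMult (2 ^ M) k * fourierCoeff u k := by
      have : P = ∑ n ∈ Finset.range (M + 1), lpProj n u := by ext x; simp [hPdef]
      rw [this, fourierCoeff.sum]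
      · simp only [Finset.sum_apply, fourierCoeff_lpProj hi]
        rw [← Finset.sum_mul, ← Complex.ofReal_sum, sum_lpMult]
      · intro n _
        rw [← volume_eq_haarAddCircle]
        exact integrable_of_continuous (continuous_lpProj hi n)
    rw [fourierCoeff_eq_integral] at h1 ⊢
    simp only [mul_sub]
    rw [integral_sub (integrable_fourier_mul hi _)
      (integrable_fourier_mul (integrable_of_continuous hPc) _), h1, ← fourierCoeff_eq_integral]
    push_cast; ring
  have hm : MemLp (fun x => u x - P x) 2 := hu.sub (memLp_of_continuous hPc 2)
  simp only [Function.comp]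
  rw [← tsum_enorm_fourierCoeff_sq hm]
  change _ ≤ ∑' k : {k | k ∉ Finset.Icc (-(M : ℤ)) M}, ‖fourierCoeff u k‖ₑ ^ 2
  rw [tsum_subtype {k | k ∉ Finset.Icc (-(M : ℤ)) M} fun k => ‖fourierCoeff u k‖ₑ ^ 2]
  refine ENNReal.tsum_le_tsum fun k => ?_
  rw [hco]
  -- The partial sum has multiplier `vpMult (2 ^ M)`, equal to `1` for `|k| ≤ M`, so the error sees
  -- only the tail of the Fourier series.
  by_cases hk : k ∈ Finset.Icc (-(M : ℤ)) M
  · have h1 : |k| ≤ M := abs_le.2 (Finset.mem_Icc.1 hk)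
    have h2 : (M : ℤ) ≤ 2 ^ M := by exact_mod_cast (Nat.lt_two_pow_self (n := M)).le
    rw [vpMult_eq_one (by push_cast; linarith)]
    simp
  · rw [Set.indicator_of_mem (by exact hk), enorm_mul]
    gcongr
    refine mul_le_of_le_one_left' ?_
    rw [← ofReal_norm, Complex.norm_real, Real.norm_of_nonneg (by linarith [vpMult_le_one (2 ^ M) k])]
    simpa using vpMult_nonneg _ _

/-! ### Pointwise and integral bounds for the kernels -/

theorem norm_fourier (k : ℤ) (x : UnitAddCircle) : ‖(fourier k x : ℂ)‖ = 1 := by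
  rw [fourier_apply, Circle.norm_coe]

theorem norm_le_half (x : UnitAddCircle) : ‖x‖ ≤ 1 / 2 := by
  simpa using AddCircle.norm_le_half_period (x := x) 1 one_ne_zero

theorem norm_fourier_coe_sub_one (k : ℤ) (z : ℝ) :
    ‖(fourier k (z : UnitAddCircle) : ℂ) - 1‖ = 2 * |Real.sin (Real.pi * k * z)| := by
  rw [fourier_coe_apply]
  have := Complex.norm_exp_I_mul_ofReal_sub_one (2 * Real.pi * k * z)
  rw [show 2 * Real.pi * k * z / 2 = Real.pi * k * z by ring, norm_mul] at this
  simp only [Real.norm_eq_abs, abs_two] at this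
  rw [← this]
  congr 3
  push_cast; ring

theorem norm_fourier_sub_one_le (k : ℤ) (x : UnitAddCircle) :
    ‖(fourier k x : ℂ) - 1‖ ≤ 2 * Real.pi * |(k : ℝ)| * ‖x‖ := by
  obtain ⟨z, rfl, hz⟩ := exists_real_rep x
  rw [norm_fourier_coe_sub_one, ← hz]
  have h := Real.abs_sin_le_abs (x := Real.pi * k * z)
  rw [abs_mul, abs_mul, abs_of_pos Real.pi_pos] at h
  linarith

theorem le_norm_fourier_one_sub_one (x : UnitAddCircle) :
    4 * ‖x‖ ≤ ‖(fourier 1 x : ℂ) - 1‖ := by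
  have hx := norm_le_half x
  obtain ⟨z, rfl, hz⟩ := exists_real_rep x
  rw [norm_fourier_coe_sub_one, ← hz]
  rw [← hz] at hx
  have hp := Real.pi_pos
  have h1 : |Real.pi * (1 : ℤ) * z| = Real.pi * |z| := by
    rw [Int.cast_one, mul_one, abs_mul, abs_of_pos hp]
  have h := Real.mul_abs_le_abs_sin (x := Real.pi * (1 : ℤ) * z) (by rw [h1]; nlinarith)
  have h2 : 2 / Real.pi * (Real.pi * |z|) = 2 * |z| := by field_simp
  rw [h1, h2] at h
  simp only [Int.cast_one, mul_one] at h ⊢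
  linarith

/-- The analytic exponential sum `∑_{i=0}^N e^{2πi i x}`. -/
def expSum (N : ℕ) (x : UnitAddCircle) : ℂ := ∑ i ∈ Finset.range (N + 1), fourier i x

theorem continuous_expSum (N : ℕ) : Continuous (expSum N) := by
  unfold expSum; fun_prop

theorem norm_expSum_le (N : ℕ) (x : UnitAddCircle) : ‖expSum N x‖ ≤ N + 1 := by
  refine (norm_sum_le _ _).trans ?_
  simp only [norm_fourier]; simp

theorem fourier_natCast (i : ℕ) (x : UnitAddCircle) :
    (fourier (i : ℤ) x : ℂ) = (fourier 1 x : ℂ) ^ i := by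
  induction i with
  | zero => simp
  | succ i ih => rw [Nat.cast_succ, fourier_add, ih, pow_succ]

/-- Geometric summation gives `e_{N+1} - 1` after multiplication by `e_1 - 1`, and the latter has
modulus at least `4‖x‖`. -/
theorem norm_expSum_mul_le (N : ℕ) (x : UnitAddCircle) : 2 * ‖x‖ * ‖expSum N x‖ ≤ 1 := by
  have h1 : expSum N x * ((fourier 1 x : ℂ) - 1) = (fourier 1 x : ℂ) ^ (N + 1) - 1 := by
    simp only [expSum, fourier_natCast]
    exact geom_sum_mul _ _
  have h2 : ‖expSum N x‖ * ‖(fourier 1 x : ℂ) - 1‖ ≤ 2 := by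
    rw [← norm_mul, h1]
    refine (norm_sub_le _ _).trans ?_
    rw [norm_pow, norm_fourier]; norm_num
  nlinarith [le_norm_fourier_one_sub_one x, norm_nonneg (expSum N x)]

/-- Near `0` the terms do not cancel: the `i`-th differs from `1` by at most `2π i ‖x‖`, and these
errors add up to at most half of `N + 1`. -/
theorem le_norm_expSum (N : ℕ) (x : UnitAddCircle) (h : 2 * Real.pi * N * ‖x‖ ≤ 1) :
    ((N : ℝ) + 1) / 2 ≤ ‖expSum N x‖ := by
  have h1 : ‖((N : ℂ) + 1) - expSum N x‖ ≤ ((N : ℝ) + 1) / 2 := by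
    have h2 : ((N : ℂ) + 1) - expSum N x = ∑ i ∈ Finset.range (N + 1), (1 - fourier i x) := by
      simp [expSum]
    rw [h2]
    have h3 : ∀ i ∈ Finset.range (N + 1),
        ‖(1 : ℂ) - fourier i x‖ ≤ 2 * Real.pi * ‖x‖ * i := fun i _ => by
      rw [norm_sub_rev]
      refine (norm_fourier_sub_one_le _ _).trans (le_of_eq ?_)
      simp; ring
    refine (norm_sum_le_of_le _ h3).trans ?_
    rw [← Finset.mul_sum]
    have h4 : (∑ i ∈ Finset.range (N + 1), (i : ℝ)) = N * (N + 1) / 2 := by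
      have := Finset.sum_range_id_mul_two (N + 1)
      have h5 : (∑ i ∈ Finset.range (N + 1), (i : ℝ)) * 2 = ((N : ℝ) + 1) * N := by
        rw [Nat.add_sub_cancel] at this
        have := congrArg (Nat.cast : ℕ → ℝ) this
        push_cast at this
        exact this
      linarith
    rw [h4]
    nlinarith
  have h2 : ‖(N : ℂ) + 1‖ = (N : ℝ) + 1 := by
    have := Complex.norm_natCast (N + 1)
    push_cast at this; exact this
  have := norm_sub_norm_le ((N : ℂ) + 1) (((N : ℂ) + 1) - expSum N x)
  rw [sub_sub_cancel, h2] at this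
  linarith

theorem sum_Icc_neg_self (N : ℕ) (f : ℤ → ℂ) :
    ∑ j ∈ Finset.Icc (-(N : ℤ)) N, f j =
      f 0 + ∑ i ∈ Finset.range N, (f (i + 1) + f (-(i + 1))) := by
  induction N with
  | zero => simp
  | succ N ih =>
    have : Finset.Icc (-((N + 1 : ℕ) : ℤ)) (N + 1 : ℕ) =
        insert ((N : ℤ) + 1) (insert (-((N : ℤ) + 1)) (Finset.Icc (-(N : ℤ)) N)) := by
      ext j; simp only [Finset.mem_Icc, Finset.mem_insert]; push_cast; lia
    rw [this, Finset.sum_insert, Finset.sum_insert, ih, Finset.sum_range_succ]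
    · ring
    · simp
    · simp only [Finset.mem_insert, Finset.mem_Icc]; lia

theorem sq_norm_expSum (N : ℕ) (x : UnitAddCircle) :
    ((‖expSum N x‖ ^ 2 : ℝ) : ℂ) = (N + 1) +
      ∑ i ∈ Finset.range N, ((N : ℂ) - i) * (fourier (i + 1) x + fourier (-(i + 1)) x) := by
  have hsq : ∀ z : ℂ, ((‖z‖ ^ 2 : ℝ) : ℂ) = z * (starRingEnd ℂ) z := fun z => by
    rw [Complex.mul_conj, Complex.normSq_eq_norm_sq]
  induction N with
  | zero => simp [expSum]
  | succ N ih =>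
    have h1 : expSum (N + 1) x = expSum N x + fourier ((N : ℤ) + 1) x := by
      rw [expSum, Finset.sum_range_succ]; push_cast; rfl
    have hc : (starRingEnd ℂ) (expSum N x) = ∑ i ∈ Finset.range (N + 1), fourier (-(i : ℤ)) x := by
      rw [expSum, map_sum]; simp only [fourier_neg]
    have h2 : expSum N x * fourier (-((N : ℤ) + 1)) x =
        ∑ i ∈ Finset.range (N + 1), fourier (-((i : ℤ) + 1)) x := by
      rw [expSum, Finset.sum_mul, ← Finset.sum_range_reflect]
      refine Finset.sum_congr rfl fun i hi => ?_
      have := Finset.mem_range.1 hi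
      rw [← fourier_add]
      congr 2; push_cast [Nat.le_of_lt_succ this]; lia
    have h3 : (starRingEnd ℂ) (expSum N x) * fourier ((N : ℤ) + 1) x =
        ∑ i ∈ Finset.range (N + 1), fourier ((i : ℤ) + 1) x := by
      rw [hc, Finset.sum_mul, ← Finset.sum_range_reflect]
      refine Finset.sum_congr rfl fun i hi => ?_
      have := Finset.mem_range.1 hi
      rw [← fourier_add]
      congr 2; push_cast [Nat.le_of_lt_succ this]; lia
    have h4 : (fourier ((N : ℤ) + 1) x : ℂ) * fourier (-((N : ℤ) + 1)) x = 1 := by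
      rw [← fourier_add, add_neg_cancel, fourier_zero]
    rw [hsq] at ih
    rw [hsq, h1, map_add, ← fourier_neg]
    have h5 : ∑ i ∈ Finset.range (N + 1),
        (((N + 1 : ℕ) : ℂ) - i) * (fourier ((i : ℤ) + 1) x + fourier (-((i : ℤ) + 1)) x) =
        ∑ i ∈ Finset.range N, ((N : ℂ) - i) * (fourier ((i : ℤ) + 1) x + fourier (-((i : ℤ) + 1)) x) +
        (∑ i ∈ Finset.range (N + 1), (fourier ((i : ℤ) + 1) x : ℂ) +
        ∑ i ∈ Finset.range (N + 1), (fourier (-((i : ℤ) + 1)) x : ℂ)) := by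
      rw [← Finset.sum_add_distrib]
      have : ∑ i ∈ Finset.range N, ((N : ℂ) - i) * (fourier ((i : ℤ) + 1) x + fourier (-((i : ℤ) + 1)) x)
        = ∑ i ∈ Finset.range (N + 1), ((N : ℂ) - i) * (fourier ((i : ℤ) + 1) x + fourier (-((i : ℤ) + 1)) x) := by
        rw [Finset.sum_range_succ]; simp
      rw [this, ← Finset.sum_add_distrib]
      refine Finset.sum_congr rfl fun i _ => ?_
      push_cast; ring
    rw [h5, ← h3, ← h2]
    push_cast
    linear_combination ih + h4

/-- The square form makes the kernel nonnegative, transfers the size and decay bounds of `expSum`,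
and turns its `L¹` norm into a Parseval sum. -/
theorem fejer_eq_sq_norm_expSum (N : ℕ) (x : UnitAddCircle) :
    fejer N x = ((‖expSum N x‖ ^ 2 / (N + 1) : ℝ) : ℂ) := by
  have hN : ((N : ℂ) + 1) ≠ 0 := by exact_mod_cast N.succ_ne_zero
  rw [Complex.ofReal_div, sq_norm_expSum, fejer, sum_Icc_neg_self]
  push_cast
  rw [eq_div_iff hN, add_mul, Finset.sum_mul]
  congr 1
  · simp
  · refine Finset.sum_congr rfl fun i _ => ?_
    have h : |(i : ℤ) + 1| = (i : ℤ) + 1 := abs_of_nonneg (by positivity)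
    rw [abs_neg, h]
    push_cast
    field_simp
    ring

theorem norm_fejer (N : ℕ) (x : UnitAddCircle) :
    ‖fejer N x‖ = ‖expSum N x‖ ^ 2 / (N + 1) := by
  rw [fejer_eq_sq_norm_expSum, Complex.norm_real, Real.norm_of_nonneg (by positivity)]

theorem norm_fejer_le (N : ℕ) (x : UnitAddCircle) : ‖fejer N x‖ ≤ N + 1 := by
  rw [norm_fejer, div_le_iff₀ (by positivity), ← sq]
  exact pow_le_pow_left₀ (norm_nonneg _) (norm_expSum_le N x) 2

theorem norm_fejer_mul_le (N : ℕ) (x : UnitAddCircle) :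
    4 * ‖x‖ ^ 2 * (N + 1) * ‖fejer N x‖ ≤ 1 := by
  rw [norm_fejer]
  have h := pow_le_pow_left₀ (by positivity) (norm_expSum_mul_le N x) 2
  have : 4 * ‖x‖ ^ 2 * (N + 1) * (‖expSum N x‖ ^ 2 / (N + 1)) = (2 * ‖x‖ * ‖expSum N x‖) ^ 2 := by
    field_simp; ring
  rw [this]; simpa using h

theorem expSum_eq_trigPoly (N : ℕ) :
    expSum N = trigPoly ((Finset.range (N + 1)).map Nat.castEmbedding) fun _ => 1 := by
  ext x; simp [expSum, trigPoly]

theorem lintegral_fejer_le (N : ℕ) : ∫⁻ x, ‖fejer N x‖ₑ ≤ 1 := by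
  have h := tsum_enorm_fourierCoeff_sq (memLp_of_continuous (continuous_expSum N) 2)
  have h2 : ∑' k : ℤ, ‖fourierCoeff (expSum N) k‖ₑ ^ 2 = (N + 1 : ℕ) := by
    rw [expSum_eq_trigPoly]
    simp only [fourierCoeff_trigPoly]
    rw [tsum_eq_sum (s := (Finset.range (N + 1)).map Nat.castEmbedding)
      fun k hk => by rw [if_neg hk]; simp]
    rw [Finset.sum_congr rfl fun k hk => by rw [if_pos hk]]
    simp
  rw [h2] at h
  have h3 : ∀ x, ‖fejer N x‖ₑ = ((N + 1 : ℕ) : ℝ≥0∞)⁻¹ * ‖expSum N x‖ₑ ^ 2 := fun x => by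
    rw [← ofReal_norm, norm_fejer, ← ofReal_norm, ← ENNReal.ofReal_pow (norm_nonneg _),
      ENNReal.ofReal_div_of_pos (by positivity), ENNReal.div_eq_inv_mul]
    congr 2
    rw [← ENNReal.ofReal_natCast]; push_cast; rfl
  simp only [h3]
  rw [lintegral_const_mul' _ _ (by simp), ← h]
  exact (ENNReal.inv_mul_cancel (by simp) (by simp)).le

theorem continuous_fejer (n : ℕ) : Continuous (fejer n) := by
  rw [fejer_eq_trigPoly subset_rfl]; exact continuous_trigPoly _ _

theorem norm_valleePoussin_le (m : ℕ) (x : UnitAddCircle) :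
    ‖valleePoussin m x‖ ≤ 5 * (m + 1) := by
  have h1 := norm_fejer_le (2 * m + 1) x
  have h2 := norm_fejer_le m x
  have h3 := norm_sub_le (2 * fejer (2 * m + 1) x) (fejer m x)
  rw [norm_mul, Complex.norm_ofNat] at h3
  push_cast at h1
  exact h3.trans (by linarith)

theorem norm_valleePoussin_mul_le (m : ℕ) (x : UnitAddCircle) :
    2 * ‖x‖ ^ 2 * (m + 1) * ‖valleePoussin m x‖ ≤ 1 := by
  have h1 := norm_fejer_mul_le (2 * m + 1) x
  have h2 := norm_fejer_mul_le m x
  have h3 := norm_sub_le (2 * fejer (2 * m + 1) x) (fejer m x)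
  rw [norm_mul, Complex.norm_ofNat] at h3
  push_cast at h1
  have h4 := mul_le_mul_of_nonneg_left h3 (show 0 ≤ 2 * ‖x‖ ^ 2 * (m + 1) by positivity)
  exact h4.trans (by linarith)

/-- This is the only kernel bound that the far part needs; behaviour near `0` is left to the `L²`
theory. -/
theorem norm_deltaKernel_mul_le (n : ℕ) (x : UnitAddCircle) :
    ‖x‖ ^ 2 * 2 ^ n * ‖deltaKernel n x‖ ≤ 2 := by
  cases n with
  | zero =>
    have h := norm_valleePoussin_mul_le 1 x
    have : 0 ≤ ‖x‖ ^ 2 * ‖valleePoussin 1 x‖ := by positivity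
    simp only [deltaKernel, pow_zero, mul_one]
    push_cast at h
    linarith
  | succ n =>
    have h1 := norm_valleePoussin_mul_le (2 ^ (n + 1)) x
    have h2 := norm_valleePoussin_mul_le (2 ^ n) x
    have h3 := norm_sub_le (valleePoussin (2 ^ (n + 1)) x) (valleePoussin (2 ^ n) x)
    have h4 := mul_le_mul_of_nonneg_left h3 (show 0 ≤ ‖x‖ ^ 2 * 2 ^ (n + 1) by positivity)
    have h5 : 0 ≤ ‖x‖ ^ 2 * ‖valleePoussin (2 ^ (n + 1)) x‖ := by positivity
    have h6 : 0 ≤ ‖x‖ ^ 2 * ‖valleePoussin (2 ^ n) x‖ := by positivity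
    have h7 : 0 ≤ ‖x‖ ^ 2 * ‖valleePoussin (2 ^ (n + 1)) x‖ * 2 ^ n := by positivity
    simp only [deltaKernel]
    refine h4.trans ?_
    push_cast at h1 h2
    have h8 : (2 : ℝ) ^ (n + 1) = 2 * 2 ^ n := by ring
    rw [h8] at h1 ⊢
    nlinarith

/-! ### Bernstein's inequality -/

theorem fourierCoeff_fejer_mul_fourier (n : ℕ) (i k : ℤ) :
    fourierCoeff (fun x => fejer n x * fourier i x) k = fejerMult n (k - i) := by
  rw [fourierCoeff_mul_fourier, fejer_eq_trigPoly subset_rfl, fourierCoeff_trigPoly]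
  split_ifs with h
  · rfl
  · rw [fejerMult_of_lt, Complex.ofReal_zero]
    by_contra! h2
    exact h (Finset.mem_Icc.2 (abs_le.1 h2))

/-- The kernel that reproduces the derivative of trigonometric sums of degree at most `n + 1`. -/
def bernsteinKernel (n : ℕ) (x : UnitAddCircle) : ℂ :=
  fejer n x * fourier (n + 1) x - fejer n x * fourier (-(n + 1)) x

theorem continuous_bernsteinKernel (n : ℕ) : Continuous (bernsteinKernel n) := by
  have := continuous_fejer n
  unfold bernsteinKernel; fun_prop

/-- The multiplier is the difference of two tents centred at `±(n + 1)`, which is linear between the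
two centres. Up to the factor `2πi(n + 1)`, convolution with this kernel therefore differentiates.
-/
theorem fourierCoeff_bernsteinKernel {n : ℕ} {k : ℤ} (hk : |k| ≤ n + 1) :
    fourierCoeff (bernsteinKernel n) k = k / (n + 1) := by
  have hc := continuous_fejer n
  have h : fourierCoeff (bernsteinKernel n) k =
      fourierCoeff (fun x => fejer n x * fourier (n + 1) x) k -
        fourierCoeff (fun x => fejer n x * fourier (-(n + 1)) x) k := by
    simp only [fourierCoeff_eq_integral, bernsteinKernel, mul_sub]
    exact integral_sub (integrable_of_continuous (by fun_prop))
      (integrable_of_continuous (by fun_prop))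
  rw [h, fourierCoeff_fejer_mul_fourier, fourierCoeff_fejer_mul_fourier, fejerMult, fejerMult]
  have hn : (0 : ℝ) < n + 1 := by positivity
  have h1 : |(k : ℝ)| ≤ n + 1 := by exact_mod_cast hk
  obtain ⟨h2, h3⟩ := abs_le.1 h1
  rw [← Complex.ofReal_sub]
  push_cast [-Complex.ofReal_sub]
  rw [abs_of_nonpos (show (k : ℝ) - (n + 1) ≤ 0 by linarith),
    abs_of_nonneg (show 0 ≤ (k : ℝ) - -(n + 1) by linarith)]
  have h4 : 1 - -((k : ℝ) - (n + 1)) / (n + 1) = k / (n + 1) := by field_simp; ring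
  have h5 : 1 - ((k : ℝ) - -(n + 1)) / (n + 1) = -(k / (n + 1)) := by field_simp; ring
  have h6 : max 0 ((k : ℝ) / (n + 1)) - max 0 (-((k : ℝ) / (n + 1))) = k / (n + 1) := by
    generalize (k : ℝ) / (n + 1) = y
    clear * -
    grind
  rw [h4, h5, h6]; push_cast; rfl

theorem lintegral_bernsteinKernel_le (n : ℕ) : ∫⁻ x, ‖bernsteinKernel n x‖ₑ ≤ 2 := by
  have h : ∀ x, ‖bernsteinKernel n x‖ₑ ≤ 2 * ‖fejer n x‖ₑ := fun x => by
    refine (enorm_sub_le).trans (le_of_eq ?_)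
    have : ∀ k : ℤ, ‖(fourier k x : ℂ)‖ₑ = 1 := fun k => by
      rw [← ofReal_norm, norm_fourier, ENNReal.ofReal_one]
    rw [enorm_mul, enorm_mul, this, this, mul_one, two_mul]
  refine (lintegral_mono h).trans ?_
  rw [lintegral_const_mul' _ _ (by simp)]
  exact (mul_le_mul_right (lintegral_fejer_le n) 2).trans (by simp)

/-- Bernstein's inequality for trigonometric sums of degree at most `n + 1`. -/
theorem norm_trigPoly_deriv_le {n : ℕ} {s : Finset ℤ} (hs : ∀ k ∈ s, |k| ≤ (n : ℤ) + 1)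
    (c : ℤ → ℂ) {B : ℝ} (hB : ∀ x, ‖trigPoly s c x‖ ≤ B) (x : UnitAddCircle) :
    ‖trigPoly s (fun k => 2 * Real.pi * Complex.I * k * c k) x‖ ≤ 4 * Real.pi * (n + 1) * B := by
  have hB0 : 0 ≤ B := (norm_nonneg _).trans (hB 0)
  have hn : ((n : ℂ) + 1) ≠ 0 := by exact_mod_cast n.succ_ne_zero
  have hκ := integrable_of_continuous (continuous_bernsteinKernel n)
  have h : trigPoly s (fun k => 2 * Real.pi * Complex.I * k * c k) x =
      2 * Real.pi * Complex.I * (n + 1) * ∫ t, bernsteinKernel n t * trigPoly s c (x - t) := by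
    rw [convolution_with_trigPoly hκ, trigPoly, trigPoly, Finset.mul_sum]
    refine Finset.sum_congr rfl fun k hk => ?_
    rw [fourierCoeff_bernsteinKernel (hs k hk)]
    field_simp
  have hI : ∫ t, ‖bernsteinKernel n t‖ ≤ 2 := by
    rw [integral_norm_eq_lintegral_enorm hκ.aestronglyMeasurable]
    exact ENNReal.toReal_le_of_le_ofReal (by norm_num)
      (by simpa using lintegral_bernsteinKernel_le n)
  have h2 : ‖∫ t, bernsteinKernel n t * trigPoly s c (x - t)‖ ≤ 2 * B := by
    refine (norm_integral_le_of_norm_le (hκ.norm.mul_const B)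
      (Eventually.of_forall fun t => ?_)).trans ?_
    · rw [norm_mul]; exact mul_le_mul_of_nonneg_left (hB _) (norm_nonneg _)
    · rw [integral_mul_const]; exact mul_le_mul_of_nonneg_right hI hB0
  rw [h, norm_mul]
  have h3 : ‖2 * (Real.pi : ℂ) * Complex.I * ((n : ℂ) + 1)‖ = 2 * Real.pi * (n + 1) := by
    have : ‖((n : ℂ) + 1)‖ = (n : ℝ) + 1 := by
      have := Complex.norm_natCast (n + 1)
      push_cast at this; exact this
    simp [this, abs_of_pos Real.pi_pos]
  rw [h3]
  have := Real.pi_pos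
  calc 2 * Real.pi * (n + 1) * _ ≤ 2 * Real.pi * (n + 1) * (2 * B) := by gcongr
    _ = _ := by ring

theorem norm_trigPoly_sub_le {n : ℕ} {s : Finset ℤ} (hs : ∀ k ∈ s, |k| ≤ (n : ℤ) + 1)
    (c : ℤ → ℂ) {B : ℝ} (hB : ∀ x, ‖trigPoly s c x‖ ≤ B) (x a : UnitAddCircle) :
    ‖trigPoly s c x - trigPoly s c a‖ ≤ 4 * Real.pi * (n + 1) * B * ‖x - a‖ := by
  obtain ⟨α, rfl, -⟩ := exists_real_rep a
  obtain ⟨z, hz, hz'⟩ := exists_real_rep (x - (α : UnitAddCircle))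
  have hx : x = ((α + z : ℝ) : UnitAddCircle) := by simp [hz]
  have hd : ∀ y : ℝ, HasDerivAt (fun y : ℝ => trigPoly s c (y : UnitAddCircle))
      (trigPoly s (fun k => 2 * Real.pi * Complex.I * k * c k) (y : UnitAddCircle)) y := fun y => by
    unfold trigPoly
    refine HasDerivAt.fun_sum fun k _ => ?_
    refine ((hasDerivAt_fourier 1 k y).const_mul (c k)).congr_deriv ?_
    simp only [Complex.ofReal_one, div_one]; ring
  have := Convex.norm_image_sub_le_of_norm_hasDerivWithin_le (s := Set.univ) (x := α) (y := α + z)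
    (fun y _ => (hd y).hasDerivWithinAt)
    (fun y _ => norm_trigPoly_deriv_le hs c hB (y : UnitAddCircle)) convex_univ trivial trivial
  rw [← hx, add_sub_cancel_left, Real.norm_eq_abs, hz'] at this
  exact this

/-! ### Slow growth of `ρ` -/

theorem one_le_log_add_exp {t : ℝ} (ht : 0 ≤ t) : 1 ≤ Real.log (t + Real.exp 1) := by
  rw [Real.le_log_iff_exp_le (by positivity)]; linarith

theorem psiInv_nonneg (r s : ℝ) : 0 ≤ psiInv r s := Real.sInf_nonneg fun _ h => h.1

theorem psiInv_pos {r s : ℝ} (hs : 0 < s) : 0 < psiInv r s := by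
  refine lt_of_le_of_ne (psiInv_nonneg r s) fun h => ?_
  have h2 := psi_psiInv (r := r) hs.le
  rw [← h, psi, zero_div] at h2
  exact hs.ne h2

theorem psiInv_le_psiInv {r s t : ℝ} (hs : 0 ≤ s) (hst : s ≤ t) : psiInv r s ≤ psiInv r t :=
  csInf_le_csInf ⟨0, fun _ h => h.1⟩
    ⟨psiInv r t, psiInv_nonneg r t, (psi_psiInv (hs.trans hst)).ge⟩
    fun _ h => ⟨h.1, hst.trans h.2⟩

/-- For large `r` the function `psi r` need not be monotone, so the growth estimate rests on this
fixed-point equation and on the monotonicity of `psiInv`. -/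
theorem psiInv_eq {r s : ℝ} (hs : 0 ≤ s) :
    psiInv r s = s * Real.log (psiInv r s + Real.exp 1) ^ r := by
  have h := psi_psiInv (r := r) hs
  have h1 := one_le_log_add_exp (psiInv_nonneg r s)
  have h2 : 0 < Real.log (psiInv r s + Real.exp 1) ^ r := Real.rpow_pos_of_pos (by linarith) r
  rw [psi, div_eq_iff h2.ne'] at h
  exact h

theorem rho_pos {r t : ℝ} (ht : 0 < t) : 0 < rho r t :=
  div_pos (inv_pos.2 ht) (psiInv_pos (inv_pos.2 ht))

/-- The exponential lies above its tangent at `log (5r + 1)`. The slope `5r` is chosen so that `4ry`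
survives after one `ry` is absorbed, and this produces the exponent `1/4`. -/
theorem exists_mul_add_le_exp_add {r : ℝ} (hr : 0 ≤ r) :
    ∃ K : ℝ, ∀ y : ℝ, 0 ≤ y → 5 * r * y + 1 ≤ Real.exp y + K := by
  set s : ℝ := 5 * r + 1
  have hs : 0 < s := by positivity
  refine ⟨1 - s * (1 - Real.log s), fun y hy => ?_⟩
  have h := Real.add_one_le_exp (y - Real.log s)
  rw [Real.exp_sub, Real.exp_log hs, le_div_iff₀ hs] at h
  have : s * y = 5 * r * y + y := by ring
  nlinarith

/-- The weight `ρ_r` grows at most like a small power. -/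
theorem exists_rho_le {r : ℝ} (hr : 0 ≤ r) :
    ∃ A : ℝ, 0 < A ∧ ∀ s t : ℝ, 0 < s → s ≤ t → rho r t ≤ A * (t / s) ^ (1 / 4 : ℝ) * rho r s := by
  obtain ⟨K, hK⟩ := exists_mul_add_le_exp_add hr
  refine ⟨Real.exp (K / 4), Real.exp_pos _, fun s t hs hst => ?_⟩
  have ht : 0 < t := hs.trans_le hst
  have hinv : t⁻¹ ≤ s⁻¹ := inv_anti₀ hs hst
  have hT := psiInv_eq (r := r) (inv_pos.2 hs).le
  have hT' := psiInv_eq (r := r) (inv_pos.2 ht).le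
  have hTT := psiInv_le_psiInv (r := r) (inv_pos.2 ht).le hinv
  have hTpos := psiInv_pos (r := r) (inv_pos.2 hs)
  have hTpos' := psiInv_pos (r := r) (inv_pos.2 ht)
  rw [rho, rho]
  set T := psiInv r s⁻¹
  set T' := psiInv r t⁻¹
  set L := Real.log (T + Real.exp 1) with hL
  set L' := Real.log (T' + Real.exp 1) with hL'
  have hL1 : 1 ≤ L := one_le_log_add_exp hTpos.le
  have hL1' : 1 ≤ L' := one_le_log_add_exp hTpos'.le
  have he := Real.exp_pos 1
  have hLL : L' ≤ L := Real.log_le_log (by positivity) (by linarith)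
  have hlam : 1 ≤ t / s := (one_le_div hs).2 hst
  -- The fixed-point equation gives `ρ(s) = L^{-r}` and `ρ(t) = L'^{-r}`, so the ratio to bound is
  -- `ρ(t)/ρ(s) = e^{ry}`.
  set y := Real.log (L / L') with hy
  have hq : 1 ≤ L / L' := (one_le_div (by linarith)).2 hLL
  have hy0 : 0 ≤ y := Real.log_nonneg hq
  have hey : Real.exp y = L / L' := Real.exp_log (by linarith)
  have hqr : (L / L') ^ r = Real.exp (r * y) := by
    rw [← hey, ← Real.exp_mul, mul_comm]
  have hqr1 : 1 ≤ (L / L') ^ r := Real.one_le_rpow hq hr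
  have hLr : 0 < L ^ r := Real.rpow_pos_of_pos (by linarith) r
  have hLr' : 0 < L' ^ r := Real.rpow_pos_of_pos (by linarith) r
  have hdiv : (L / L') ^ r = L ^ r / L' ^ r := Real.div_rpow (by linarith) (by linarith) r
  have hTeq : T = t / s * (L / L') ^ r * T' := by
    rw [hdiv, hT, hT']; field_simp
  have h1 : L ≤ Real.log (t / s) + r * y + L' := by
    have : T + Real.exp 1 ≤ t / s * (L / L') ^ r * (T' + Real.exp 1) := by
      have h2 : 1 ≤ t / s * (L / L') ^ r := one_le_mul_of_one_le_of_one_le hlam hqr1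
      rw [hTeq]; nlinarith
    have h3 := Real.log_le_log (by positivity) this
    rwa [Real.log_mul (by positivity) (by positivity), Real.log_mul (by positivity) (by positivity),
      hqr, Real.log_exp] at h3
  -- Dividing the bound on `L` by `L' ≥ 1` bounds `e^y` by an expression linear in `y`, which forces
  -- `ry` to be at most a quarter of `log (t/s)` plus a constant.
  have h2 : Real.exp y ≤ 1 + Real.log (t / s) + r * y := by
    rw [hey, div_le_iff₀ (by linarith)]
    have : 0 ≤ Real.log (t / s) + r * y := by
      have := Real.log_nonneg hlam
      positivity
    nlinarith
  have h3 := hK y hy0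
  have h4 : r * y ≤ K / 4 + Real.log (t / s) * (1 / 4) := by linarith
  have h5 : (L / L') ^ r ≤ Real.exp (K / 4) * (t / s) ^ (1 / 4 : ℝ) := by
    rw [hqr, Real.rpow_def_of_pos (by linarith), ← Real.exp_add]
    exact Real.exp_le_exp.2 h4
  have h6 : t⁻¹ / T' = (L / L') ^ r * (s⁻¹ / T) := by
    rw [hTeq]; field_simp
  rw [h6]
  exact mul_le_mul_of_nonneg_right h5 (by positivity)

/-! ### Mean oscillation controls the square function -/

/-- The normalising weight `ρ_r(ℓ)² ℓ` with values in `[0, ∞]`. -/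
def arcWeight (r ℓ : ℝ) : ℝ≥0∞ := ENNReal.ofReal (rho r ℓ ^ 2 * ℓ)

theorem arcWeight_ne_zero {r ℓ : ℝ} (h0 : 0 < ℓ) : arcWeight r ℓ ≠ 0 := by
  have := rho_pos (r := r) h0
  simp only [arcWeight, ne_eq, ENNReal.ofReal_eq_zero, not_le]
  positivity

theorem arcWeight_ne_top (r ℓ : ℝ) : arcWeight r ℓ ≠ ∞ := ENNReal.ofReal_ne_top

theorem arcWeight_eq {r ℓ : ℝ} (h0 : 0 < ℓ) :
    arcWeight r ℓ = ENNReal.ofReal ℓ * ENNReal.ofReal (rho r ℓ) ^ 2 := by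
  have := rho_pos (r := r) h0
  rw [arcWeight, ENNReal.ofReal_mul (by positivity), ENNReal.ofReal_pow this.le, mul_comm]

theorem volume_univ_unitAddCircle : volume (Set.univ : Set UnitAddCircle) = 1 := by
  rw [← arc_one 0, volume_arc 0 le_rfl, ENNReal.ofReal_one]

theorem lintegral_osc_le (r : ℝ) (u : UnitAddCircle → ℂ) (a : ℝ) {ℓ : ℝ} (h0 : 0 < ℓ)
    (h1 : ℓ ≤ 1) :
    ∫⁻ x in arc a ℓ, ‖u x - ⨍ y in arc a ℓ, u y‖ₑ ^ 2 ≤ arcWeight r ℓ * oscSup r u := by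
  rw [← ENNReal.inv_mul_le_iff (arcWeight_ne_zero h0) (arcWeight_ne_top r ℓ)]
  exact le_iSup₂_of_le a ℓ (le_iSup_of_le ⟨h0, h1⟩ le_rfl)

theorem lintegral_square_le (r : ℝ) (u : UnitAddCircle → ℂ) (a : ℝ) {ℓ : ℝ} (h0 : 0 < ℓ)
    (h1 : ℓ ≤ 1) :
    ∫⁻ x in arc a ℓ, ∑' n : {n : ℕ // ℓ⁻¹ ≤ (2 : ℝ) ^ n}, ‖lpProj n u x‖ₑ ^ 2 ≤
      arcWeight r ℓ * squareSupClosed r u := by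
  rw [← ENNReal.inv_mul_le_iff (arcWeight_ne_zero h0) (arcWeight_ne_top r ℓ)]
  exact le_iSup₂_of_le a ℓ (le_iSup_of_le ⟨h0, h1⟩ le_rfl)

/-- The growth condition on `ρ_r` with constant `A`. -/
def RhoGrowth (r A : ℝ) : Prop :=
  0 < A ∧ ∀ s t : ℝ, 0 < s → s ≤ t → rho r t ≤ A * (t / s) ^ (1 / 4 : ℝ) * rho r s

theorem arcWeight_le {r A s t q : ℝ} (hA : RhoGrowth r A) (hs : 0 < s) (hst : s ≤ t)
    (hq : t / s ≤ q) :
    arcWeight r t ≤ ENNReal.ofReal (A ^ 2 * q ^ (3 / 2 : ℝ)) * arcWeight r s := by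
  have ht : 0 < t := hs.trans_le hst
  have hq1 : 1 ≤ t / s := (one_le_div hs).2 hst
  have hq0 : 0 < q := by linarith
  have hrs := rho_pos (r := r) hs
  have hrt := rho_pos (r := r) ht
  have hA0 := hA.1
  rw [arcWeight, arcWeight, ← ENNReal.ofReal_mul (by positivity)]
  refine ENNReal.ofReal_le_ofReal ?_
  have h1 : rho r t ≤ A * q ^ (1 / 4 : ℝ) * rho r s := by
    refine (hA.2 s t hs hst).trans ?_
    gcongr
  have h2 : t ≤ q * s := (div_le_iff₀ hs).1 hq
  have h3 : q ^ (3 / 2 : ℝ) = (q ^ (1 / 4 : ℝ)) ^ 2 * q := by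
    rw [← Real.rpow_natCast, ← Real.rpow_mul hq0.le, ← Real.rpow_add_one hq0.ne']
    norm_num
  calc rho r t ^ 2 * t ≤ (A * q ^ (1 / 4 : ℝ) * rho r s) ^ 2 * (q * s) := by gcongr
    _ = _ := by rw [h3]; ring

/-- The arc and its translate lie in a common arc of length at most `(1 + |j|)ℓ`, or in the whole
circle if that exceeds `1`; both means are compared with the mean there. The exponent `3/2` is `1`
from the length plus `2 · 1/4` from the growth of `ρ²`. -/
theorem lintegral_translate_le {r A : ℝ} (hA : RhoGrowth r A) {u : UnitAddCircle → ℂ}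
    (hu : MemLp u 2) (a : ℝ) {ℓ : ℝ} (h0 : 0 < ℓ) (h1 : ℓ ≤ 1) (j : ℤ) :
    ∫⁻ x in arc (a + j * ℓ) ℓ, ‖u x - ⨍ y in arc a ℓ, u y‖ₑ ^ 2 ≤
      ENNReal.ofReal (4 * A ^ 2 * (1 + |(j : ℝ)|) ^ (3 / 2 : ℝ)) *
        (arcWeight r ℓ * oscSup r u) := by
  obtain ⟨b, m, hm0, hm1, hJ, hI, hℓm, hmq⟩ : ∃ b m : ℝ, 0 < m ∧ m ≤ 1 ∧
      arc (a + j * ℓ) ℓ ⊆ arc b m ∧ arc a ℓ ⊆ arc b m ∧ ℓ ≤ m ∧ m / ℓ ≤ 1 + |(j : ℝ)| := by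
    have hj := abs_nonneg (j : ℝ)
    by_cases h : (1 + |(j : ℝ)|) * ℓ ≤ 1
    · refine ⟨min a (a + j * ℓ), (1 + |(j : ℝ)|) * ℓ, by positivity, h, ?_, ?_, by nlinarith,
        by rw [mul_div_cancel_right₀ _ h0.ne']⟩
      · refine arc_subset_arc (min_le_right _ _) ?_
        rcases le_total 0 (j : ℝ) with hj | hj
        · rw [abs_of_nonneg hj, min_eq_left (by nlinarith)]; linarith
        · rw [abs_of_nonpos hj, min_eq_right (by nlinarith)]; nlinarith
      · refine arc_subset_arc (min_le_left _ _) ?_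
        rcases le_total 0 (j : ℝ) with hj | hj
        · rw [abs_of_nonneg hj, min_eq_left (by nlinarith)]; nlinarith
        · rw [abs_of_nonpos hj, min_eq_right (by nlinarith)]; linarith
    · refine ⟨a, 1, one_pos, le_rfl, by rw [arc_one]; exact Set.subset_univ _,
        by rw [arc_one]; exact Set.subset_univ _, h1, ?_⟩
      rw [div_le_iff₀ h0]; linarith
  set cI := ⨍ y in arc a ℓ, u y
  set cB := ⨍ y in arc b m, u y
  have hB : ∫⁻ x in arc b m, ‖u x - cB‖ₑ ^ 2 ≤ arcWeight r m * oscSup r u :=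
    lintegral_osc_le r u b hm0 hm1
  have h := setLIntegral_enorm_add_sq_le (s := arc (a + j * ℓ) ℓ) (f := fun x => u x - cB)
    (g := fun _ => cB - cI) (hu.aestronglyMeasurable.sub aestronglyMeasurable_const).aemeasurable
  simp only [sub_add_sub_cancel, lintegral_const, Measure.restrict_apply_univ,
    volume_arc _ h1] at h
  have h2 : ‖cB - cI‖ₑ ^ 2 * ENNReal.ofReal ℓ ≤ ∫⁻ x in arc a ℓ, ‖u x - cB‖ₑ ^ 2 := by
    rw [mul_comm, ← enorm_neg, neg_sub]
    exact enorm_setAverage_sub_sq_le h0 h1 hu cB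
  calc _ ≤ 2 * (∫⁻ x in arc (a + j * ℓ) ℓ, ‖u x - cB‖ₑ ^ 2) +
        2 * ∫⁻ x in arc a ℓ, ‖u x - cB‖ₑ ^ 2 := h.trans (by gcongr)
    _ ≤ 2 * (∫⁻ x in arc b m, ‖u x - cB‖ₑ ^ 2) + 2 * ∫⁻ x in arc b m, ‖u x - cB‖ₑ ^ 2 := by
        gcongr
    _ = 4 * ∫⁻ x in arc b m, ‖u x - cB‖ₑ ^ 2 := by ring
    _ ≤ 4 * (ENNReal.ofReal (A ^ 2 * (1 + |(j : ℝ)|) ^ (3 / 2 : ℝ)) * arcWeight r ℓ *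
          oscSup r u) := by
        gcongr
        refine hB.trans ?_
        gcongr
        exact arcWeight_le hA h0 hℓm hmq
    _ = _ := by
        rw [mul_assoc (4 : ℝ), ENNReal.ofReal_mul (by norm_num : (0 : ℝ) ≤ 4)]
        simp only [ENNReal.ofReal_ofNat]; ring

theorem tsum_weight_mul (α β p q : ℝ) (hα : 0 ≤ α) (hβ : 0 ≤ β) (X : ℝ≥0∞) :
    ∑' j : ℤ, ENNReal.ofReal (α * (1 + |(j : ℝ)|) ^ (-p)) *
      (ENNReal.ofReal (β * (1 + |(j : ℝ)|) ^ q) * X) =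
      ENNReal.ofReal (α * β) * weightSum (p - q) * X := by
  rw [weightSum, ← ENNReal.tsum_mul_left, ← ENNReal.tsum_mul_right]
  refine tsum_congr fun j => ?_
  have hj : 0 < 1 + |(j : ℝ)| := by positivity
  rw [← mul_assoc, ← ENNReal.ofReal_mul (by positivity), ← ENNReal.ofReal_mul (by positivity)]
  congr 2
  rw [show -(p - q) = -p + q by ring, Real.rpow_add hj]; ring

theorem lintegral_near_le {r A : ℝ} (hA : RhoGrowth r A) {u : UnitAddCircle → ℂ}
    (hu : MemLp u 2) (a : ℝ) {ℓ : ℝ} (h0 : 0 < ℓ) (h1 : ℓ ≤ 1) :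
    ∫⁻ x, ‖{x : UnitAddCircle | ‖x - (a : UnitAddCircle)‖ < 2 * ℓ}.indicator
      (fun x => u x - ⨍ y in arc a ℓ, u y) x‖ₑ ^ 2 ≤
      ENNReal.ofReal (64 * (4 * A ^ 2)) * weightSum (3 - 3 / 2) * (arcWeight r ℓ * oscSup r u) := by
  rw [← tsum_weight_mul _ _ _ _ (by norm_num) (by positivity)]
  refine (lintegral_le_tsum_arc a h0 h1 _ (fun x => ‖u x - ⨍ y in arc a ℓ, u y‖ₑ ^ 2)
    -- Near points have `|j| < 3`, so `64 = 4³` makes this weight at least `1` on them; the power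
    -- `-3` makes the sum converge against the growth `3/2`.
    (fun j => ENNReal.ofReal (64 * (1 + |(j : ℝ)|) ^ (-3 : ℝ))) (fun j => ENNReal.ofReal_ne_top)
    fun j x hx hj => ?_).trans (ENNReal.tsum_le_tsum fun j =>
      mul_le_mul_right (lintegral_translate_le hA hu a h0 h1 j) _)
  by_cases hx2 : x ∈ {x : UnitAddCircle | ‖x - (a : UnitAddCircle)‖ < 2 * ℓ}
  · rw [Set.indicator_of_mem hx2]
    refine le_mul_of_one_le_left zero_le ?_
    rw [ENNReal.one_le_ofReal]
    have h2 : ‖x - (a : UnitAddCircle)‖ / ℓ < 2 := (div_lt_iff₀ h0).2 hx2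
    have hj0 := abs_nonneg (j : ℝ)
    rw [Real.rpow_neg (by positivity), ← div_eq_mul_inv, le_div_iff₀ (by positivity), one_mul]
    have h3 : 1 + |(j : ℝ)| ≤ 4 := by linarith
    calc (1 + |(j : ℝ)|) ^ (3 : ℝ) ≤ 4 ^ (3 : ℝ) := by gcongr
      _ = 64 := by norm_num
  · rw [Set.indicator_of_notMem hx2]; simp

theorem enorm_lpProj_le (n : ℕ) (f : UnitAddCircle → ℂ) (x : UnitAddCircle) :
    ‖lpProj n f x‖ₑ ≤ ∫⁻ y, ‖deltaKernel n (x - y)‖ₑ * ‖f y‖ₑ := by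
  have h := lintegral_sub_left_eq_self (μ := (volume : Measure UnitAddCircle))
    (fun t => ‖deltaKernel n t‖ₑ * ‖f (x - t)‖ₑ) x
  simp only [sub_sub_cancel] at h
  rw [h]
  refine (enorm_integral_le_lintegral_enorm _).trans (le_of_eq ?_)
  refine lintegral_congr fun t => ?_
  simp [enorm_mul]

/-- Kernel decay `(1 + |j|)^{-2}` meets `L¹` growth `(1 + |j|)^{3/4}` of the oscillation over
translates; the sum converges since `2 - 3/4 > 1`. -/
theorem enorm_lpProj_far_le {r A : ℝ} (hA : RhoGrowth r A) {u : UnitAddCircle → ℂ}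
    (hu : MemLp u 2) (a : ℝ) {ℓ : ℝ} (h0 : 0 < ℓ) (h1 : ℓ ≤ 1) (n : ℕ) {x : UnitAddCircle}
    (hx : x ∈ arc a ℓ) :
    ‖lpProj n ({x : UnitAddCircle | ‖x - (a : UnitAddCircle)‖ < 2 * ℓ}ᶜ.indicator
      (fun x => u x - ⨍ y in arc a ℓ, u y)) x‖ₑ ≤
      ENNReal.ofReal ((2 ^ n * ℓ)⁻¹) * (ENNReal.ofReal (64 * A) * ENNReal.ofReal (rho r ℓ) *
        weightSum (2 - 3 / 4) * oscSup r u ^ (1 / 2 : ℝ)) := by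
  have hA0 := hA.1
  have hρ := rho_pos (r := r) h0
  set O := oscSup r u ^ (1 / 2 : ℝ) with hO
  have hO2 : oscSup r u = O ^ 2 := by
    rw [hO, ← ENNReal.rpow_natCast, ← ENNReal.rpow_mul]; norm_num
  set c := ⨍ y in arc a ℓ, u y
  have hL1 : ∀ j : ℤ, ∫⁻ y in arc (a + j * ℓ) ℓ, ‖u y - c‖ₑ ≤
      ENNReal.ofReal (2 * A * rho r ℓ * ℓ * (1 + |(j : ℝ)|) ^ (3 / 4 : ℝ)) * O := fun j => by
    have hj : 0 < 1 + |(j : ℝ)| := by positivity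
    have h2 := setLIntegral_arc_le_of_sq (a := a + j * ℓ) h1
      (F := fun y => ‖u y - c‖ₑ)
      (m := ENNReal.ofReal (2 * A * rho r ℓ * (1 + |(j : ℝ)|) ^ (3 / 4 : ℝ)) * O)
      (hu.aestronglyMeasurable.sub aestronglyMeasurable_const).enorm ?_
    · refine h2.trans (le_of_eq ?_)
      rw [← mul_assoc, ← ENNReal.ofReal_mul h0.le]
      congr 2; ring
    · refine (lintegral_translate_le hA hu a h0 h1 j).trans (le_of_eq ?_)
      rw [hO2, arcWeight, mul_pow, ← mul_assoc, ← mul_assoc, ← ENNReal.ofReal_mul (by positivity),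
        ← ENNReal.ofReal_pow (by positivity), ← ENNReal.ofReal_mul h0.le]
      congr 2
      have : (1 + |(j : ℝ)|) ^ (3 / 2 : ℝ) = ((1 + |(j : ℝ)|) ^ (3 / 4 : ℝ)) ^ 2 := by
        rw [← Real.rpow_natCast, ← Real.rpow_mul hj.le]; norm_num
      rw [this]; ring
  refine (enorm_lpProj_le _ _ _).trans ((lintegral_le_tsum_arc a h0 h1 _ (fun x => ‖u x - c‖ₑ)
    (fun j => ENNReal.ofReal (32 / (2 ^ n * ℓ ^ 2) * (1 + |(j : ℝ)|) ^ (-2 : ℝ)))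
    (fun j => ENNReal.ofReal_ne_top) fun j y hy hj => ?_).trans
      ((ENNReal.tsum_le_tsum fun j => mul_le_mul_right (hL1 j) _).trans (le_of_eq ?_)))
  · by_cases hy2 : y ∈ {x : UnitAddCircle | ‖x - (a : UnitAddCircle)‖ < 2 * ℓ}ᶜ
    · rw [Set.indicator_of_mem hy2]
      refine mul_le_mul_left ?_ _
      rw [← ofReal_norm]
      refine ENNReal.ofReal_le_ofReal ?_
      have hd : 2 * ℓ ≤ ‖y - (a : UnitAddCircle)‖ := not_lt.1 hy2
      set d := ‖y - (a : UnitAddCircle)‖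
      have hxa := norm_sub_le_of_mem_arc hx
      have hxy : d / 2 ≤ ‖x - y‖ := by
        have : d ≤ ‖x - (a : UnitAddCircle)‖ + ‖x - y‖ := by
          rw [norm_sub_rev x y]
          have := norm_add_le (y - x) (x - (a : UnitAddCircle))
          rw [sub_add_sub_cancel] at this
          linarith
        linarith
      have hj0 := abs_nonneg (j : ℝ)
      -- Here `(1 + |j|)ℓ ≤ 2ℓ + d ≤ 2d`, while `d/2 ≤ ‖x - y‖`.
      have h3 : ℓ * (1 + |(j : ℝ)|) / 4 ≤ ‖x - y‖ := by
        have h4 : |(j : ℝ)| * ℓ ≤ ℓ + d := by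
          have := mul_le_mul_of_nonneg_right hj h0.le
          rwa [add_mul, one_mul, div_mul_cancel₀ _ h0.ne'] at this
        nlinarith
      have h5 := norm_deltaKernel_mul_le n (x - y)
      rw [Real.rpow_neg (by positivity), ← div_eq_mul_inv, div_div, le_div_iff₀ (by positivity)]
      have h6 : (ℓ * (1 + |(j : ℝ)|) / 4) ^ 2 ≤ ‖x - y‖ ^ 2 := by gcongr
      have h7 : (ℓ * (1 + |(j : ℝ)|) / 4) ^ 2 * (2 ^ n * ‖deltaKernel n (x - y)‖) ≤ 2 := by
        refine le_trans ?_ h5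
        rw [mul_assoc]; gcongr
      rw [Real.rpow_two]
      nlinarith
    · rw [Set.indicator_of_notMem hy2]; simp
  · rw [tsum_weight_mul _ _ _ _ (by positivity) (by positivity),
      show (32 / (2 ^ n * ℓ ^ 2) * (2 * A * rho r ℓ * ℓ)) = (2 ^ n * ℓ)⁻¹ * (64 * A * rho r ℓ) by
        field_simp; ring,
      ENNReal.ofReal_mul (by positivity), ENNReal.ofReal_mul (p := 64 * A) (by positivity)]
    ring

/-- The index `0` is isolated because `Δ_0`, unlike the other pieces, does not annihilate constants.
Among arcs it is seen only by the whole circle. -/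
theorem tsum_high_eq (ℓ : ℝ) (h0 : 0 < ℓ) (F : ℕ → ℝ≥0∞) :
    ∑' n : {n : ℕ // ℓ⁻¹ ≤ (2 : ℝ) ^ n}, F n =
      (if 1 ≤ ℓ then F 0 else 0) +
        ∑' n : ℕ, if ℓ⁻¹ ≤ (2 : ℝ) ^ (n + 1) then F (n + 1) else 0 := by
  change ∑' n : {n : ℕ | ℓ⁻¹ ≤ (2 : ℝ) ^ n}, F n = _
  rw [tsum_subtype {n : ℕ | ℓ⁻¹ ≤ (2 : ℝ) ^ n} F, tsum_eq_zero_add' ENNReal.summable]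
  simp only [Set.indicator_apply, Set.mem_ofPred_eq, pow_zero, inv_le_one₀ h0]

theorem tsum_geometric_high_le {ℓ : ℝ} (h0 : 0 < ℓ) :
    ∑' n : ℕ, (if ℓ⁻¹ ≤ (2 : ℝ) ^ (n + 1) then ENNReal.ofReal ((2 ^ (n + 1) * ℓ)⁻¹) ^ 2 else 0)
      ≤ 2 := by
  have hex : ∃ n : ℕ, ℓ⁻¹ ≤ (2 : ℝ) ^ (n + 1) := by
    obtain ⟨n, hn⟩ := pow_unbounded_of_one_lt ℓ⁻¹ (one_lt_two : (1 : ℝ) < 2)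
    exact ⟨n, hn.le.trans (pow_le_pow_right₀ (by norm_num) n.le_succ)⟩
  classical
  set k := Nat.find hex
  have hk : ℓ⁻¹ ≤ (2 : ℝ) ^ (k + 1) := Nat.find_spec hex
  rw [← Summable.sum_add_tsum_nat_add' (k := k) ENNReal.summable, Finset.sum_eq_zero, zero_add]
  · calc _ ≤ ∑' n : ℕ, (2⁻¹ : ℝ≥0∞) ^ n := ENNReal.tsum_le_tsum fun n => ?_
      _ = 2 := by rw [ENNReal.tsum_geometric, ENNReal.one_sub_inv_two, inv_inv]
    split_ifs
    · have h1 : (2 ^ (n + k + 1) * ℓ)⁻¹ ≤ ((2 : ℝ)⁻¹) ^ n := by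
        rw [inv_pow]
        refine inv_anti₀ (by positivity) ?_
        have : 1 ≤ 2 ^ (k + 1) * ℓ := by rwa [inv_le_iff_one_le_mul₀ h0] at hk
        calc (2 : ℝ) ^ n = 2 ^ n * 1 := by ring
          _ ≤ 2 ^ n * (2 ^ (k + 1) * ℓ) := by gcongr
          _ = _ := by ring
      have h2 : ENNReal.ofReal ((2 ^ (n + k + 1) * ℓ)⁻¹) ≤ (2⁻¹ : ℝ≥0∞) ^ n := by
        refine (ENNReal.ofReal_le_ofReal h1).trans (le_of_eq ?_)
        rw [ENNReal.ofReal_pow (by norm_num), ENNReal.ofReal_inv_of_pos (by norm_num),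
          ENNReal.ofReal_ofNat]
      calc _ ≤ ((2⁻¹ : ℝ≥0∞) ^ n) ^ 2 := by gcongr
        _ ≤ _ := by
          rw [sq]
          exact mul_le_of_le_one_left' (pow_le_one₀ zero_le (by simp))
    · exact zero_le
  · intro n hn
    rw [if_neg (Nat.find_min hex (Finset.mem_range.1 hn))]

/-- The near part is summed in `L²` over all `n`; the far part is bounded pointwise and summed
through the square summable factor `(2^n ℓ)^{-1}`. -/
theorem lintegral_square_arc_le {r A : ℝ} (hA : RhoGrowth r A) {u : UnitAddCircle → ℂ}
    (hu : MemLp u 2) (a : ℝ) {ℓ : ℝ} (h0 : 0 < ℓ) (h1 : ℓ ≤ 1) :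
    ∫⁻ x in arc a ℓ, ∑' n : ℕ,
      (if ℓ⁻¹ ≤ (2 : ℝ) ^ (n + 1) then ‖lpProj (n + 1) u x‖ₑ ^ 2 else 0) ≤
      (2 * (ENNReal.ofReal (64 * (4 * A ^ 2)) * weightSum (3 - 3 / 2)) +
        4 * (ENNReal.ofReal (64 * A) * weightSum (2 - 3 / 4)) ^ 2) *
          (arcWeight r ℓ * oscSup r u) := by
  set c := ⨍ y in arc a ℓ, u y with hc
  set N : Set UnitAddCircle := {x : UnitAddCircle | ‖x - (a : UnitAddCircle)‖ < 2 * ℓ} with hN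
  have hNm : MeasurableSet N := measurableSet_lt (by fun_prop) measurable_const
  set f := N.indicator fun x => u x - c with hf
  set g := Nᶜ.indicator fun x => u x - c with hg
  have hm : MemLp (fun x => u x - c) 2 := hu.sub (memLp_const c)
  have hfm : MemLp f 2 := hm.indicator hNm
  have hgm : MemLp g 2 := hm.indicator hNm.compl
  have hfg : (fun x => u x - c) = fun x => f x + g x := by
    ext x; exact (congrFun (Set.indicator_self_add_compl N fun x => u x - c) x).symm
  set Q : ℝ≥0∞ := ENNReal.ofReal (64 * A) * ENNReal.ofReal (rho r ℓ) *
        weightSum (2 - 3 / 4) * oscSup r u ^ (1 / 2 : ℝ) with hQ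
  have hproj : ∀ n x, lpProj (n + 1) u x = lpProj (n + 1) f x + lpProj (n + 1) g x := fun n x => by
    rw [← lpProj_add (integrable_of_memLp_two hfm) (integrable_of_memLp_two hgm), ← hfg,
      lpProj_succ_sub_const (integrable_of_memLp_two hu)]
  have hpt : ∀ x ∈ arc a ℓ,
      ∑' n : ℕ, (if ℓ⁻¹ ≤ (2 : ℝ) ^ (n + 1) then ‖lpProj (n + 1) u x‖ₑ ^ 2 else 0) ≤
        2 * (∑' n : ℕ, ‖lpProj n f x‖ₑ ^ 2) + 4 * Q ^ 2 := fun x hx => by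
    have h2 : ∀ n : ℕ, (if ℓ⁻¹ ≤ (2 : ℝ) ^ (n + 1) then ‖lpProj (n + 1) u x‖ₑ ^ 2 else 0) ≤
        2 * ‖lpProj (n + 1) f x‖ₑ ^ 2 + 2 * Q ^ 2 *
          (if ℓ⁻¹ ≤ (2 : ℝ) ^ (n + 1) then ENNReal.ofReal ((2 ^ (n + 1) * ℓ)⁻¹) ^ 2 else 0) :=
      fun n => by
        split_ifs
        · rw [hproj]
          refine (enorm_add_sq_le _ _).trans ?_
          have := enorm_lpProj_far_le hA hu a h0 h1 (n + 1) hx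
          rw [mul_add]
          refine add_le_add le_rfl ?_
          calc 2 * ‖lpProj (n + 1) g x‖ₑ ^ 2
              ≤ 2 * (ENNReal.ofReal ((2 ^ (n + 1) * ℓ)⁻¹) * Q) ^ 2 := by gcongr
            _ = _ := by ring
        · exact zero_le
    refine (ENNReal.tsum_le_tsum h2).trans ?_
    rw [ENNReal.tsum_add, ENNReal.tsum_mul_left, ENNReal.tsum_mul_left]
    have h3 : ∑' n : ℕ, ‖lpProj (n + 1) f x‖ₑ ^ 2 ≤ ∑' n : ℕ, ‖lpProj n f x‖ₑ ^ 2 :=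
      ENNReal.tsum_comp_le_tsum_of_injective (Nat.succ_injective) _
    calc _ ≤ 2 * (∑' n : ℕ, ‖lpProj n f x‖ₑ ^ 2) + 2 * Q ^ 2 * 2 := by
          gcongr
          exact tsum_geometric_high_le h0
      _ = _ := by ring
  have hmeas : ∀ n, Measurable fun x => ‖lpProj n f x‖ₑ ^ 2 := fun n =>
    ((continuous_lpProj (integrable_of_memLp_two hfm) n).enorm.measurable).pow_const 2
  calc _ ≤ ∫⁻ x in arc a ℓ, (2 * (∑' n : ℕ, ‖lpProj n f x‖ₑ ^ 2) + 4 * Q ^ 2) :=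
        setLIntegral_mono' (measurableSet_arc a h1) hpt
    _ = 2 * (∫⁻ x in arc a ℓ, ∑' n : ℕ, ‖lpProj n f x‖ₑ ^ 2) + 4 * Q ^ 2 * ENNReal.ofReal ℓ := by
        rw [lintegral_add_right _ measurable_const, lintegral_const_mul' _ _ (by simp),
          lintegral_const, Measure.restrict_apply_univ, volume_arc a h1]
    _ ≤ 2 * (∫⁻ x, ‖f x‖ₑ ^ 2) + 4 * Q ^ 2 * ENNReal.ofReal ℓ := by
        refine add_le_add (mul_le_mul_right ((setLIntegral_le_lintegral _ _).trans ?_) 2) le_rfl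
        rw [lintegral_tsum fun n => (hmeas n).aemeasurable]
        exact tsum_lintegral_lpProj_le hfm
    _ ≤ 2 * (ENNReal.ofReal (64 * (4 * A ^ 2)) * weightSum (3 - 3 / 2) *
          (arcWeight r ℓ * oscSup r u)) + 4 * Q ^ 2 * ENNReal.ofReal ℓ := by
        gcongr
        exact lintegral_near_le hA hu a h0 h1
    _ = _ := by
        have hO2 : oscSup r u = (oscSup r u ^ (1 / 2 : ℝ)) ^ 2 := by
          rw [← ENNReal.rpow_natCast, ← ENNReal.rpow_mul]; norm_num
        rw [hQ, arcWeight_eq h0]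
        generalize oscSup r u ^ (1 / 2 : ℝ) = o at hO2 ⊢
        rw [hO2]
        ring

/-- The square function is controlled by the mean oscillation. -/
theorem exists_squareSupClosed_le {r : ℝ} (hr : 0 ≤ r) :
    ∃ C : ℝ≥0∞, C ≠ ∞ ∧ ∀ u : UnitAddCircle → ℂ, MemLp u 2 →
      squareSupClosed r u ≤ C * (oscSup r u + ‖∫ x, u x‖ₑ ^ 2) := by
  obtain ⟨A, hA⟩ := exists_rho_le hr
  set D : ℝ≥0∞ := 2 * (ENNReal.ofReal (64 * (4 * A ^ 2)) * weightSum (3 - 3 / 2)) +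
        4 * (ENNReal.ofReal (64 * A) * weightSum (2 - 3 / 4)) ^ 2 with hD
  have hDtop : D ≠ ∞ := by
    have h1 := (weightSum_lt_top (show (1 : ℝ) < 3 - 3 / 2 by norm_num)).ne
    have h2 := (weightSum_lt_top (show (1 : ℝ) < 2 - 3 / 4 by norm_num)).ne
    finiteness
  have hw0 := arcWeight_ne_zero (r := r) one_pos
  refine ⟨D + 2 + 2 * (arcWeight r 1)⁻¹, by finiteness, fun u hu => ?_⟩
  have hi := integrable_of_memLp_two hu
  have hzero : ∀ a : ℝ, ∫⁻ x in arc a 1, ‖lpProj 0 u x‖ₑ ^ 2 ≤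
      arcWeight r 1 * (2 * oscSup r u + 2 * (arcWeight r 1)⁻¹ * ‖∫ x, u x‖ₑ ^ 2) := fun a => by
    have h1 : ∫⁻ x, ‖lpProj 0 u x‖ₑ ^ 2 ≤ ∫⁻ x, ‖u x‖ₑ ^ 2 :=
      (ENNReal.le_tsum (f := fun n => ∫⁻ x, ‖lpProj n u x‖ₑ ^ 2) 0).trans
        (tsum_lintegral_lpProj_le hu)
    have h2 := lintegral_osc_le r u a one_pos le_rfl
    have hav : ⨍ y in arc a 1, u y = ∫ y, u y := by
      rw [arc_one, setAverage_eq, measureReal_def, volume_univ_unitAddCircle, setIntegral_univ]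
      simp
    rw [hav, arc_one, setLIntegral_univ] at h2
    have h3 := setLIntegral_enorm_add_sq_le (s := Set.univ) (f := fun x => u x - ∫ y, u y)
      (g := fun _ => ∫ y, u y)
      (hu.aestronglyMeasurable.sub aestronglyMeasurable_const).aemeasurable
    simp only [sub_add_cancel, lintegral_const, Measure.restrict_univ,
      volume_univ_unitAddCircle, mul_one] at h3
    rw [arc_one, setLIntegral_univ]
    refine h1.trans (h3.trans ?_)
    calc _ ≤ 2 * (arcWeight r 1 * oscSup r u) +
          (arcWeight r 1 * (arcWeight r 1)⁻¹) * (2 * ‖∫ x, u x‖ₑ ^ 2) := by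
          rw [ENNReal.mul_inv_cancel hw0 (arcWeight_ne_top r 1), one_mul]
          gcongr
      _ = _ := by ring
  refine iSup₂_le fun a ℓ => iSup_le fun ⟨h0, h1⟩ => ?_
  change (arcWeight r ℓ)⁻¹ * _ ≤ _
  rw [ENNReal.inv_mul_le_iff (arcWeight_ne_zero h0) (arcWeight_ne_top r ℓ)]
  rw [lintegral_congr fun x => tsum_high_eq ℓ h0 fun n => ‖lpProj n u x‖ₑ ^ 2]
  have hm : Measurable fun x => if 1 ≤ ℓ then ‖lpProj 0 u x‖ₑ ^ 2 else 0 := by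
    split_ifs
    · exact ((continuous_lpProj hi 0).enorm.measurable).pow_const 2
    · exact measurable_const
  rw [lintegral_add_left hm]
  have h3 := lintegral_square_arc_le hA hu a h0 h1
  rw [← hD] at h3
  have h4 : ∫⁻ x in arc a ℓ, (if 1 ≤ ℓ then ‖lpProj 0 u x‖ₑ ^ 2 else 0) ≤
      arcWeight r ℓ * (2 * oscSup r u + 2 * (arcWeight r 1)⁻¹ * ‖∫ x, u x‖ₑ ^ 2) := by
    split_ifs with h
    · obtain rfl : ℓ = 1 := le_antisymm h1 h
      exact hzero a
    · simp
  refine (add_le_add h4 h3).trans ?_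
  calc _ = arcWeight r ℓ * ((D + 2) * oscSup r u + 2 * (arcWeight r 1)⁻¹ * ‖∫ x, u x‖ₑ ^ 2) := by
        ring
    _ ≤ arcWeight r ℓ * ((D + 2 + 2 * (arcWeight r 1)⁻¹) * oscSup r u +
        (D + 2 + 2 * (arcWeight r 1)⁻¹) * ‖∫ x, u x‖ₑ ^ 2) := by
        refine mul_le_mul_right (add_le_add ?_ ?_) _
        · exact mul_le_mul_left le_self_add _
        · exact mul_le_mul_left le_add_self _
    _ = _ := by ring

/-! ### The square function controls mean oscillation: low frequencies -/

/-- The multiplier of the kernel equals `1` on the whole spectrum of `Δ_n u`. Reproducing the piece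
by a kernel concentrated at scale `2^{-n}` turns local `L²` averages into pointwise bounds. -/
theorem lpProj_eq_convolution {u : UnitAddCircle → ℂ} (hu : Integrable u) (n : ℕ)
    (x : UnitAddCircle) :
    lpProj n u x = ∫ t, valleePoussin (2 ^ (n + 1)) t * lpProj n u (x - t) := by
  set s := Finset.Icc (-(2 * (2 ^ (n + 1) : ℕ) + 1 : ℤ)) (2 * (2 ^ (n + 1) : ℕ) + 1) with hs
  have h2 : (0 : ℤ) < 2 ^ (n + 1) := by positivity
  rw [valleePoussin_eq_trigPoly (s := s) subset_rfl,
    convolution_trigPoly (integrable_of_continuous (continuous_lpProj hu n)),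
    lpProj_eq_trigPoly hu (s := s)
      (Finset.Icc_subset_Icc (by push_cast; lia) (by push_cast; lia))]
  refine congrFun (trigPoly_congr fun k _ => ?_) x
  rw [← lpProj_eq_trigPoly hu (Finset.Icc_subset_Icc (by push_cast; lia) (by push_cast; lia)),
    fourierCoeff_lpProj hu]
  by_cases hk : |k| ≤ 2 ^ (n + 1) + 1
  · rw [vpMult_eq_one (by push_cast; exact hk)]; simp
  · rw [lpMult_eq_zero (not_le.1 hk)]; simp

theorem norm_valleePoussin_le_weight (n : ℕ) (x : UnitAddCircle) (j : ℤ)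
    (hj : |(j : ℝ)| ≤ 1 + ‖x‖ / (2 ^ n)⁻¹) :
    ‖valleePoussin (2 ^ (n + 1)) x‖ ≤ 135 * 2 ^ n * (1 + |(j : ℝ)|) ^ (-2 : ℝ) := by
  have hp : (1 : ℝ) ≤ 2 ^ n := one_le_pow₀ (by norm_num)
  have h1 := norm_valleePoussin_le (2 ^ (n + 1)) x
  have h2 := norm_valleePoussin_mul_le (2 ^ (n + 1)) x
  push_cast at h1 h2
  rw [pow_succ (2 : ℝ) n] at h1 h2
  rw [div_inv_eq_mul] at hj
  have hv := norm_nonneg (valleePoussin (2 ^ (n + 1)) x)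
  have hj0 := abs_nonneg (j : ℝ)
  have hx := norm_nonneg x
  rw [Real.rpow_neg (by positivity), ← div_eq_mul_inv, le_div_iff₀ (by positivity), Real.rpow_two]
  set v := ‖valleePoussin (2 ^ (n + 1)) x‖
  set p : ℝ := 2 ^ n
  rcases le_total (‖x‖ * p) 1 with h | h
  · have h3 : (1 + |(j : ℝ)|) ^ 2 ≤ 3 ^ 2 := by gcongr; linarith
    calc v * (1 + |(j : ℝ)|) ^ 2 ≤ (15 * p) * 3 ^ 2 := by gcongr; linarith
      _ = _ := by ring
  · have h3 : (1 + |(j : ℝ)|) ^ 2 ≤ (3 * (‖x‖ * p)) ^ 2 := by gcongr; linarith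
    have h4 : 0 ≤ ‖x‖ ^ 2 * v := by positivity
    calc v * (1 + |(j : ℝ)|) ^ 2 ≤ v * (3 * (‖x‖ * p)) ^ 2 := by gcongr
      _ = 9 / 4 * p * (2 * ‖x‖ ^ 2 * (p * 2) * v) := by ring
      _ ≤ 9 / 4 * p * 1 := by
        gcongr
        refine le_trans ?_ h2
        gcongr; linarith
      _ ≤ _ := by linarith

theorem enorm_sq_rpow_half (x : ℝ≥0∞) : (x ^ (1 / 2 : ℝ)) ^ 2 = x := by
  rw [← ENNReal.rpow_natCast, ← ENNReal.rpow_mul]; norm_num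

/-- Each Littlewood-Paley piece is bounded by the square seminorm at its own scale. -/
theorem enorm_lpProj_le_squareSup (r : ℝ) {u : UnitAddCircle → ℂ} (hu : Integrable u) (n : ℕ)
    (x : UnitAddCircle) :
    ‖lpProj n u x‖ₑ ≤ 135 * weightSum 2 * ENNReal.ofReal (rho r (2 ^ n)⁻¹) *
      squareSupClosed r u ^ (1 / 2 : ℝ) := by
  set ℓ : ℝ := (2 ^ n)⁻¹ with hℓ
  have h0 : 0 < ℓ := by positivity
  have h1 : ℓ ≤ 1 := inv_le_one_of_one_le₀ (one_le_pow₀ (by norm_num))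
  obtain ⟨a, ha, -⟩ := exists_real_rep x
  have hc := continuous_lpProj hu n
  have hJ : ∀ b : ℝ, ∫⁻ y in arc b ℓ, ‖lpProj n u y‖ₑ ≤
      ENNReal.ofReal ℓ * (ENNReal.ofReal (rho r ℓ) * squareSupClosed r u ^ (1 / 2 : ℝ)) :=
    fun b => by
      refine setLIntegral_arc_le_of_sq h1 hc.enorm.measurable.aemeasurable ?_
      rw [mul_pow, enorm_sq_rpow_half, ← mul_assoc, ← arcWeight_eq h0]
      refine (lintegral_mono fun y => ?_).trans (lintegral_square_le r u b h0 h1)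
      exact ENNReal.le_tsum (f := fun m : {m : ℕ // ℓ⁻¹ ≤ (2 : ℝ) ^ m} => ‖lpProj m u y‖ₑ ^ 2)
        -- The arcs have length exactly `2^{-n}`, so the non-strict inequality in the sum is what
        -- admits the index `n`, including `n = 0`.
        ⟨n, by rw [hℓ, inv_inv]⟩
  have hconv : ‖lpProj n u x‖ₑ ≤
      ∫⁻ y, ‖valleePoussin (2 ^ (n + 1)) (x - y)‖ₑ * ‖lpProj n u y‖ₑ := by
    have h := lintegral_sub_left_eq_self (μ := (volume : Measure UnitAddCircle))
      (fun t => ‖valleePoussin (2 ^ (n + 1)) t‖ₑ * ‖lpProj n u (x - t)‖ₑ) x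
    simp only [sub_sub_cancel] at h
    rw [h, lpProj_eq_convolution hu]
    refine (enorm_integral_le_lintegral_enorm _).trans (le_of_eq ?_)
    exact lintegral_congr fun t => enorm_mul _ _
  refine hconv.trans ((lintegral_le_tsum_arc a h0 h1 _ (fun y => ‖lpProj n u y‖ₑ)
    (fun j => ENNReal.ofReal (135 * 2 ^ n * (1 + |(j : ℝ)|) ^ (-2 : ℝ)))
    (fun j => ENNReal.ofReal_ne_top) fun j y _ hj => ?_).trans
      ((ENNReal.tsum_le_tsum fun j => mul_le_mul_right (hJ _) _).trans (le_of_eq ?_)))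
  · refine mul_le_mul_left ?_ _
    rw [← ofReal_norm]
    refine ENNReal.ofReal_le_ofReal (norm_valleePoussin_le_weight n (x - y) j ?_)
    rwa [ha, norm_sub_rev] at hj
  · have h2 : ∀ j : ℤ, ENNReal.ofReal (135 * 2 ^ n * (1 + |(j : ℝ)|) ^ (-2 : ℝ)) =
        ENNReal.ofReal (135 * 2 ^ n) * ENNReal.ofReal ((1 + |(j : ℝ)|) ^ (-2 : ℝ)) := fun j => by
      rw [ENNReal.ofReal_mul (by positivity)]
    simp only [h2]
    rw [ENNReal.tsum_mul_right, ENNReal.tsum_mul_left, ← weightSum]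
    have h3 : ENNReal.ofReal (135 * 2 ^ n) * ENNReal.ofReal ℓ = 135 := by
      rw [← ENNReal.ofReal_mul (by positivity), hℓ, mul_inv_cancel_right₀ (by positivity),
        ENNReal.ofReal_ofNat]
    calc _ = (ENNReal.ofReal (135 * 2 ^ n) * ENNReal.ofReal ℓ) * weightSum 2 *
          ENNReal.ofReal (rho r ℓ) * squareSupClosed r u ^ (1 / 2 : ℝ) := by ring
      _ = _ := by rw [h3]

theorem enorm_lpProj_sub_le (r : ℝ) {u : UnitAddCircle → ℂ} (hu : Integrable u)
    (hX : squareSupClosed r u ≠ ∞) (n : ℕ) (x a : UnitAddCircle) :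
    ‖lpProj n u x - lpProj n u a‖ₑ ≤ ENNReal.ofReal (12 * Real.pi * 2 ^ n * ‖x - a‖) *
      (135 * weightSum 2 * ENNReal.ofReal (rho r (2 ^ n)⁻¹) *
      squareSupClosed r u ^ (1 / 2 : ℝ)) := by
  set D := 135 * weightSum 2 * ENNReal.ofReal (rho r (2 ^ n)⁻¹) *
      squareSupClosed r u ^ (1 / 2 : ℝ) with hD
  have hDtop : D ≠ ∞ := by
    have h1 := (weightSum_lt_top (show (1 : ℝ) < 2 by norm_num)).ne
    finiteness
  have hB : ∀ x, ‖lpProj n u x‖ ≤ D.toReal := fun x => by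
    have := ENNReal.toReal_mono hDtop (enorm_lpProj_le_squareSup r hu n x)
    rwa [toReal_enorm] at this
  have hp : (1 : ℝ) ≤ 2 ^ n := one_le_pow₀ (by norm_num)
  rw [lpProj_eq_trigPoly hu subset_rfl] at hB ⊢
  have h := norm_trigPoly_sub_le (n := 2 ^ (n + 1)) (s := Finset.Icc _ _)
    (fun k hk => by push_cast; exact abs_le.2 (Finset.mem_Icc.1 hk)) _ hB x a
  rw [← ENNReal.ofReal_toReal hDtop, ← ofReal_norm, ← ENNReal.ofReal_mul
    (mul_nonneg (by have := Real.pi_pos; positivity) (norm_nonneg _))]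
  refine ENNReal.ofReal_le_ofReal (h.trans ?_)
  push_cast
  have hpi := Real.pi_pos
  calc _ ≤ 4 * Real.pi * (3 * 2 ^ n) * D.toReal * ‖x - a‖ := by
        gcongr
        rw [pow_succ]; linarith
    _ = _ := by ring

theorem sum_range_rpow_le {ℓ : ℝ} (h0 : 0 < ℓ) (k : ℕ) :
    ∑ n ∈ Finset.range k, (2 ^ n * ℓ) ^ (3 / 4 : ℝ) ≤ 3 * (2 ^ k * ℓ) ^ (3 / 4 : ℝ) := by
  have h2 : (4 / 3 : ℝ) ≤ 2 ^ (3 / 4 : ℝ) := by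
    refine le_of_pow_le_pow_left₀ (n := 4) (by norm_num) (by positivity) ?_
    rw [← Real.rpow_natCast (2 ^ (3 / 4 : ℝ)), ← Real.rpow_mul (by norm_num)]
    norm_num
  induction k with
  | zero => simp; positivity
  | succ k ih =>
    have h3 : (2 ^ (k + 1) * ℓ) ^ (3 / 4 : ℝ) = 2 ^ (3 / 4 : ℝ) * (2 ^ k * ℓ) ^ (3 / 4 : ℝ) := by
      rw [← Real.mul_rpow (by norm_num) (by positivity)]; congr 1; ring
    have h4 : 0 < (2 ^ k * ℓ) ^ (3 / 4 : ℝ) := by positivity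
    rw [Finset.sum_range_succ, h3]
    nlinarith

/-- The oscillation of the low frequencies on an arc. -/
theorem enorm_low_sub_le {r A : ℝ} (hA : RhoGrowth r A) {u : UnitAddCircle → ℂ}
    (hu : Integrable u) (hX : squareSupClosed r u ≠ ∞) (a : ℝ) {ℓ : ℝ} (h0 : 0 < ℓ)
    {k : ℕ} (hk : ∀ n < k, 2 ^ n * ℓ ≤ 1) {x : UnitAddCircle} (hx : x ∈ arc a ℓ) :
    ‖∑ n ∈ Finset.range k, lpProj n u x - ∑ n ∈ Finset.range k, lpProj n u a‖ₑ ≤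
      ENNReal.ofReal (72 * Real.pi * A) * (135 * weightSum 2) *
        (ENNReal.ofReal (rho r ℓ) * squareSupClosed r u ^ (1 / 2 : ℝ)) := by
  have hpi := Real.pi_pos
  have hA0 := hA.1
  have hρ := rho_pos (r := r) h0
  have hxa := norm_sub_le_of_mem_arc hx
  have hρn : ∀ n : ℕ, 0 < rho r (2 ^ n)⁻¹ := fun n => rho_pos (by positivity)
  have hsum : ∑ n ∈ Finset.range k, (2 ^ n * ℓ) ^ (3 / 4 : ℝ) ≤ 6 := by
    cases k with
    | zero => simp
    | succ m =>
      refine (sum_range_rpow_le h0 (m + 1)).trans ?_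
      have h1 : 2 ^ (m + 1) * ℓ ≤ 2 := by
        have := hk m m.lt_succ_self
        rw [pow_succ]; linarith
      have h2 : (2 ^ (m + 1) * ℓ) ^ (3 / 4 : ℝ) ≤ 2 ^ (1 : ℝ) :=
        (Real.rpow_le_rpow (by positivity) h1 (by norm_num)).trans
          (Real.rpow_le_rpow_of_exponent_le (by norm_num) (by norm_num))
      rw [Real.rpow_one] at h2
      linarith
  have hterm : ∀ n ∈ Finset.range k, ‖lpProj n u x - lpProj n u a‖ₑ ≤
      ENNReal.ofReal ((2 ^ n * ℓ) ^ (3 / 4 : ℝ)) * (ENNReal.ofReal (12 * Real.pi * A) *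
        (135 * weightSum 2) *
        (ENNReal.ofReal (rho r ℓ) * squareSupClosed r u ^ (1 / 2 : ℝ))) := fun n hn => by
    refine (enorm_lpProj_sub_le r hu hX n x a).trans ?_
    have hnl := hk n (Finset.mem_range.1 hn)
    have hle : ℓ ≤ (2 ^ n)⁻¹ := by
      rw [le_inv_comm₀ h0 (by positivity)]
      rwa [← le_div_iff₀ h0, one_div] at hnl
    have hg := hA.2 ℓ (2 ^ n)⁻¹ h0 hle
    -- The Bernstein factor `2^n ℓ` loses `(2^n ℓ)^{-1/4}` in passing from `ρ(2^{-n})` to `ρ(ℓ)`;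
    -- the positive power `3/4` that remains makes the sum over `n < k` geometric.
    have h1 : (12 * Real.pi * 2 ^ n * ‖x - (a : UnitAddCircle)‖) * rho r (2 ^ n)⁻¹ ≤
        (2 ^ n * ℓ) ^ (3 / 4 : ℝ) * (12 * Real.pi * A) * rho r ℓ := by
      have h2 : ((2 ^ n)⁻¹ / ℓ : ℝ) = (2 ^ n * ℓ)⁻¹ := by rw [mul_inv, div_eq_mul_inv]
      have h3 : (2 ^ n * ℓ) * ((2 ^ n * ℓ)⁻¹) ^ (1 / 4 : ℝ) = (2 ^ n * ℓ) ^ (3 / 4 : ℝ) := by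
        rw [Real.inv_rpow (by positivity), ← Real.rpow_neg (by positivity)]
        nth_rewrite 1 [← Real.rpow_one (2 ^ n * ℓ)]
        rw [← Real.rpow_add (by positivity)]
        norm_num
      rw [h2] at hg
      calc _ ≤ (12 * Real.pi * 2 ^ n * ℓ) *
            (A * ((2 ^ n * ℓ)⁻¹) ^ (1 / 4 : ℝ) * rho r ℓ) := by
            have := (hρn n).le
            gcongr
        _ = _ := by rw [← h3]; ring
    have h4 := ENNReal.ofReal_le_ofReal h1
    rw [ENNReal.ofReal_mul (p := 12 * Real.pi * 2 ^ n * ‖x - (a : UnitAddCircle)‖) (by positivity),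
      ENNReal.ofReal_mul (q := rho r ℓ) (by positivity),
      ENNReal.ofReal_mul (p := (2 ^ n * ℓ) ^ (3 / 4 : ℝ)) (by positivity)] at h4
    calc _ = (ENNReal.ofReal (12 * Real.pi * 2 ^ n * ‖x - (a : UnitAddCircle)‖) *
          ENNReal.ofReal (rho r (2 ^ n)⁻¹)) * (135 * weightSum 2 *
          squareSupClosed r u ^ (1 / 2 : ℝ)) := by ring
      _ ≤ _ := mul_le_mul_left h4 _
      _ = _ := by ring
  rw [← Finset.sum_sub_distrib]
  refine (enorm_sum_le _ _).trans ((Finset.sum_le_sum hterm).trans ?_)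
  rw [← Finset.sum_mul, ← ENNReal.ofReal_sum_of_nonneg fun n _ => by positivity]
  calc _ ≤ ENNReal.ofReal 6 * (ENNReal.ofReal (12 * Real.pi * A) * (135 * weightSum 2) *
        (ENNReal.ofReal (rho r ℓ) * squareSupClosed r u ^ (1 / 2 : ℝ))) :=
        mul_le_mul_left (ENNReal.ofReal_le_ofReal hsum) _
    _ = _ := by
      rw [show 72 * Real.pi * A = 6 * (12 * Real.pi * A) by ring,
        ENNReal.ofReal_mul (p := 6) (by norm_num)]
      ring

/-! ### The square function controls mean oscillation: high frequencies -/

theorem expSum_sub (N : ℕ) (x a : UnitAddCircle) :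
    expSum N (x - a) = ∑ i ∈ Finset.range (N + 1), (fourier (-(i : ℤ)) a : ℂ) * fourier i x := by
  refine Finset.sum_congr rfl fun i _ => ?_
  simp only [fourier_apply, sub_eq_add_neg, zsmul_add, AddCircle.toCircle_add, Circle.coe_mul,
    zsmul_neg, neg_zsmul]
  ring

theorem fourierCoeff_lpProj_mul_expSum {u : UnitAddCircle → ℂ} (hu : Integrable u) (n N : ℕ)
    (a : UnitAddCircle) (k : ℤ) :
    fourierCoeff (fun x => lpProj n u x * expSum N (x - a)) k =
      ∑ i ∈ Finset.range (N + 1),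
        (fourier (-(i : ℤ)) a : ℂ) * (lpMult n (k - i) * fourierCoeff u (k - i)) := by
  have hc := continuous_lpProj hu n
  have h : (fun x => lpProj n u x * expSum N (x - a)) = ∑ i ∈ Finset.range (N + 1),
      fun x => (fourier (-(i : ℤ)) a : ℂ) * (lpProj n u x * fourier i x) := by
    ext x
    rw [expSum_sub, Finset.mul_sum, Finset.sum_apply]
    exact Finset.sum_congr rfl fun i _ => by ring
  rw [h, fourierCoeff.sum, Finset.sum_apply]
  · refine Finset.sum_congr rfl fun i _ => ?_
    rw [fourierCoeff.const_mul, fourierCoeff_mul_fourier, fourierCoeff_lpProj hu]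
  · intro i _
    rw [← volume_eq_haarAddCircle]
    exact integrable_of_continuous (by fun_prop)

/-- Multiplication by `expSum N` shifts frequencies by at most `N ≤ 2^n`. This moves the spectrum of
`Δ_n u` out to at most `3 · 2^n + 1`, so it can meet only the next two shifted shells. -/
theorem le_add_two_of_lpMult_ne_zero {k₀ N n m : ℕ} (hN : N ≤ 2 ^ k₀) (hn : k₀ ≤ n) {k : ℤ}
    {i j : ℕ} (hi : i ≤ N) (hj : j ≤ N) (h1 : lpMult n (k - i) ≠ 0)
    (h2 : lpMult m (k - j) ≠ 0) : m ≤ n + 2 := by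
  by_contra! hm
  obtain ⟨m, rfl⟩ : ∃ p, m = p + 1 := ⟨m - 1, by lia⟩
  have h3 : |k - i| ≤ 2 ^ (n + 1) + 1 := by
    by_contra! h; exact h1 (lpMult_eq_zero h)
  have h4 : 2 ^ m + 1 < |k - j| := by
    by_contra! h; exact h2 (lpMult_succ_eq_zero h)
  have h5 : (2 : ℤ) ^ (n + 2) ≤ 2 ^ m := pow_le_pow_right₀ (by norm_num) (by lia)
  have h6 : (2 : ℤ) ^ k₀ ≤ 2 ^ n := pow_le_pow_right₀ (by norm_num) hn
  have h7 : (N : ℤ) ≤ 2 ^ k₀ := by exact_mod_cast hN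
  have h8 : (2 : ℤ) ^ (n + 2) = 4 * 2 ^ n := by ring
  have h9 : (2 : ℤ) ^ (n + 1) = 2 * 2 ^ n := by ring
  have h10 : (0 : ℤ) < 2 ^ n := by positivity
  rw [abs_le] at h3
  rcases lt_abs.1 h4 with h | h <;> lia

theorem enorm_sum_sq_le_of_card_le {s : Finset ℕ} {z : ℕ → ℂ} {p : ℕ}
    (h : (s.filter fun n => z n ≠ 0).card ≤ p) :
    ‖∑ n ∈ s, z n‖ₑ ^ 2 ≤ p * ∑ n ∈ s, ‖z n‖ₑ ^ 2 := by
  have h1 : ‖∑ n ∈ s, z n‖₊ ^ 2 ≤ p * ∑ n ∈ s, ‖z n‖₊ ^ 2 := by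
    rw [← Finset.sum_filter_ne_zero s]
    calc ‖∑ n ∈ s.filter fun n => z n ≠ 0, z n‖₊ ^ 2
        ≤ (∑ n ∈ s.filter fun n => z n ≠ 0, ‖z n‖₊) ^ 2 := by
          gcongr; exact nnnorm_sum_le _ _
      _ ≤ (s.filter fun n => z n ≠ 0).card * ∑ n ∈ s.filter fun n => z n ≠ 0, ‖z n‖₊ ^ 2 :=
          sq_sum_le_card_mul_sum_sq
      _ ≤ p * ∑ n ∈ s, ‖z n‖₊ ^ 2 := by
          gcongr
          exact Finset.filter_subset _ _
  simp only [enorm_eq_nnnorm]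
  exact_mod_cast h1

/-- Almost orthogonality of the Littlewood-Paley pieces with a weight of low frequency. -/
theorem lintegral_sum_mul_expSum_le {u : UnitAddCircle → ℂ} (hu : Integrable u) {k₀ N : ℕ}
    (hN : N ≤ 2 ^ k₀) {s : Finset ℕ} (hs : ∀ n ∈ s, k₀ ≤ n) (a : UnitAddCircle) :
    ∫⁻ x, ‖(∑ n ∈ s, lpProj n u x) * expSum N (x - a)‖ₑ ^ 2 ≤
      3 * ∑ n ∈ s, ∫⁻ x, ‖lpProj n u x * expSum N (x - a)‖ₑ ^ 2 := by
  have hE := continuous_expSum N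
  have hc : ∀ n, Continuous fun x => lpProj n u x * expSum N (x - a) := fun n => by
    have := continuous_lpProj hu n
    fun_prop
  have hsum : (fun x => (∑ n ∈ s, lpProj n u x) * expSum N (x - a)) =
      ∑ n ∈ s, fun x => lpProj n u x * expSum N (x - a) := by
    ext x; rw [Finset.sum_mul, Finset.sum_apply]
  have hcs : Continuous fun x => (∑ n ∈ s, lpProj n u x) * expSum N (x - a) := by
    simp only [Finset.sum_mul]
    exact continuous_finsetSum _ fun n _ => hc n
  rw [← tsum_enorm_fourierCoeff_sq (memLp_of_continuous hcs 2)]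
  simp only [← tsum_enorm_fourierCoeff_sq (memLp_of_continuous (hc _) 2)]
  rw [← Summable.tsum_finsetSum fun n _ => ENNReal.summable, ← ENNReal.tsum_mul_left]
  refine ENNReal.tsum_le_tsum fun k => ?_
  rw [hsum, fourierCoeff.sum _ _ fun n _ => by
    rw [← volume_eq_haarAddCircle]; exact integrable_of_continuous (hc n), Finset.sum_apply]
  refine enorm_sum_sq_le_of_card_le (p := 3) ?_
  set t := s.filter fun n => fourierCoeff (fun x => lpProj n u x * expSum N (x - a)) k ≠ 0 with ht
  have hmem : ∀ n ∈ t, k₀ ≤ n ∧ ∃ i : ℕ, i ≤ N ∧ lpMult n (k - i) ≠ 0 := fun n hn => by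
    obtain ⟨h1, h2⟩ := Finset.mem_filter.1 hn
    refine ⟨hs n h1, ?_⟩
    by_contra! h3
    refine h2 ?_
    rw [fourierCoeff_lpProj_mul_expSum hu]
    refine Finset.sum_eq_zero fun i hi => ?_
    rw [h3 i (Nat.lt_succ_iff.1 (Finset.mem_range.1 hi))]; simp
  rcases t.eq_empty_or_nonempty with h | h
  · rw [h]; simp
  -- At each frequency the active indices lie within `2` of the least one, so there are at most
  -- three; this is the factor `3`.
  · have hsub : t ⊆ Finset.Icc (t.min' h) (t.min' h + 2) := fun m hm => by
      obtain ⟨h1, i, hi, h2⟩ := hmem _ (t.min'_mem h)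
      obtain ⟨-, j, hj, h3⟩ := hmem m hm
      exact Finset.mem_Icc.2 ⟨t.min'_le m hm, le_add_two_of_lpMult_ne_zero hN h1 hi hj h2 h3⟩
    refine (Finset.card_le_card hsub).trans ?_
    simp; lia

theorem sq_norm_expSum_le_weight {ℓ : ℝ} (h0 : 0 < ℓ) {N : ℕ}
    (hN : 1 ≤ 2 * Real.pi * ℓ * (N + 1)) (x : UnitAddCircle) (j : ℤ)
    (hj : |(j : ℝ)| ≤ 1 + ‖x‖ / ℓ) :
    ‖expSum N x‖ ^ 2 ≤ 100 * ((N : ℝ) + 1) ^ 2 * (1 + |(j : ℝ)|) ^ (-2 : ℝ) := by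
  have hj0 := abs_nonneg (j : ℝ)
  have hx := norm_nonneg x
  have hpi := Real.pi_pos
  have h1 := norm_expSum_le N x
  have h2 := norm_expSum_mul_le N x
  have hv := norm_nonneg (expSum N x)
  rw [Real.rpow_neg (by positivity), ← div_eq_mul_inv, le_div_iff₀ (by positivity), Real.rpow_two,
    ← mul_pow]
  have key : ‖expSum N x‖ * (1 + |(j : ℝ)|) ≤ 10 * ((N : ℝ) + 1) := by
    rcases le_total (‖x‖ / ℓ) 1 with h | h
    · calc ‖expSum N x‖ * (1 + |(j : ℝ)|) ≤ (N + 1) * 3 := by gcongr; linarith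
        _ ≤ _ := by linarith
    · calc ‖expSum N x‖ * (1 + |(j : ℝ)|) ≤ ‖expSum N x‖ * (3 * (‖x‖ / ℓ)) := by
            gcongr; linarith
        _ = 3 / (2 * ℓ) * (2 * ‖x‖ * ‖expSum N x‖) := by field_simp
        _ ≤ 3 / (2 * ℓ) * 1 := by gcongr
        _ ≤ 3 / (2 * ℓ) * (2 * Real.pi * ℓ * (N + 1)) := by gcongr
        _ = 3 * Real.pi * (N + 1) := by field_simp
        _ ≤ _ := by
          have := Real.pi_lt_d2
          gcongr; linarith
  calc _ ≤ (10 * ((N : ℝ) + 1)) ^ 2 := by gcongr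
    _ = _ := by ring

/-- The high frequencies on an arc are controlled by the square seminorm. -/
theorem lintegral_high_le (r : ℝ) {u : UnitAddCircle → ℂ} (hu : Integrable u) (a : ℝ) {ℓ : ℝ}
    (h0 : 0 < ℓ) (h1 : ℓ ≤ 1) {k₀ : ℕ} (hk : ℓ⁻¹ ≤ 2 ^ k₀) {s : Finset ℕ}
    (hs : ∀ n ∈ s, k₀ ≤ n) :
    ∫⁻ x in arc a ℓ, ‖∑ n ∈ s, lpProj n u x‖ₑ ^ 2 ≤
      1200 * weightSum 2 * (arcWeight r ℓ * squareSupClosed r u) := by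
  have hpi := Real.pi_pos
  have hpi3 := Real.pi_gt_three
  -- This is the largest `N` for which `le_norm_expSum` applies on the whole arc. It still has `N +
  -- 1 ≥ (2πℓ)⁻¹`, which gives decay at scale `ℓ`.
  set N : ℕ := ⌊(2 * Real.pi * ℓ)⁻¹⌋₊ with hNdef
  have hN1 : (N : ℝ) ≤ (2 * Real.pi * ℓ)⁻¹ := Nat.floor_le (by positivity)
  have hN2 : 1 ≤ 2 * Real.pi * ℓ * (N + 1) := by
    have := (Nat.lt_floor_add_one (2 * Real.pi * ℓ)⁻¹).le
    rwa [inv_le_iff_one_le_mul₀' (by positivity)] at this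
  have hN3 : N ≤ 2 ^ k₀ := by
    have h2 : (2 * Real.pi * ℓ)⁻¹ ≤ ℓ⁻¹ := inv_anti₀ h0 (by nlinarith)
    exact_mod_cast (hN1.trans (h2.trans hk))
  have hc := fun n => continuous_lpProj hu n
  have hE := continuous_expSum N
  set q : ℝ≥0∞ := ENNReal.ofReal ((((N : ℝ) + 1) / 2) ^ 2) with hq
  have hq0 : q ≠ 0 := by
    simp only [hq, ne_eq, ENNReal.ofReal_eq_zero, not_le]; positivity
  have hlow : q * ∫⁻ x in arc a ℓ, ‖∑ n ∈ s, lpProj n u x‖ₑ ^ 2 ≤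
      ∫⁻ x, ‖(∑ n ∈ s, lpProj n u x) * expSum N (x - a)‖ₑ ^ 2 := by
    rw [← lintegral_const_mul' _ _ ENNReal.ofReal_ne_top]
    refine (setLIntegral_mono' (measurableSet_arc a h1) fun x hx => ?_).trans
      (setLIntegral_le_lintegral _ _)
    rw [enorm_mul, mul_pow, mul_comm]
    refine mul_le_mul_right ?_ _
    rw [← ofReal_norm, ← ENNReal.ofReal_pow (norm_nonneg _)]
    refine ENNReal.ofReal_le_ofReal ?_
    gcongr
    refine le_norm_expSum N _ ?_
    have hxa := norm_sub_le_of_mem_arc hx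
    calc 2 * Real.pi * N * ‖x - (a : UnitAddCircle)‖ ≤
          2 * Real.pi * (2 * Real.pi * ℓ)⁻¹ * ℓ := by gcongr
      _ = 1 := by field_simp
  have hup : ∑ n ∈ s, ∫⁻ x, ‖lpProj n u x * expSum N (x - a)‖ₑ ^ 2 ≤
      400 * q * weightSum 2 * (arcWeight r ℓ * squareSupClosed r u) := by
    rw [← lintegral_finsetSum' _ fun n _ => by
      have := hc n
      exact (Continuous.measurable (by fun_prop)).aemeasurable]
    refine (lintegral_le_tsum_arc a h0 h1 _
      (fun x => ∑' n : {n : ℕ // ℓ⁻¹ ≤ (2 : ℝ) ^ n}, ‖lpProj n u x‖ₑ ^ 2)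
      (fun j => ENNReal.ofReal (100 * ((N : ℝ) + 1) ^ 2 * (1 + |(j : ℝ)|) ^ (-2 : ℝ)))
      (fun j => ENNReal.ofReal_ne_top) fun j x _ hj => ?_).trans
      ((ENNReal.tsum_le_tsum fun j => mul_le_mul_right (lintegral_square_le r u _ h0 h1) _).trans
        (le_of_eq ?_))
    · simp only [enorm_mul, mul_pow]
      rw [← Finset.sum_mul, mul_comm]
      refine mul_le_mul' ?_ ?_
      · rw [← ofReal_norm, ← ENNReal.ofReal_pow (norm_nonneg _)]
        exact ENNReal.ofReal_le_ofReal (sq_norm_expSum_le_weight h0 hN2 _ j hj)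
      · have hs' : ∀ n ∈ s, ℓ⁻¹ ≤ (2 : ℝ) ^ n := fun n hn =>
          hk.trans (pow_le_pow_right₀ (by norm_num) (hs n hn))
        change _ ≤ ∑' n : {n : ℕ | ℓ⁻¹ ≤ (2 : ℝ) ^ n}, ‖lpProj n u x‖ₑ ^ 2
        rw [tsum_subtype {n : ℕ | ℓ⁻¹ ≤ (2 : ℝ) ^ n} fun n => ‖lpProj n u x‖ₑ ^ 2]
        refine le_trans (le_of_eq ?_) (ENNReal.sum_le_tsum s)
        refine Finset.sum_congr rfl fun n hn => ?_
        have hn' : n ∈ {n : ℕ | ℓ⁻¹ ≤ (2 : ℝ) ^ n} := hs' n hn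
        rw [Set.indicator_of_mem hn']
    · simp only [ENNReal.ofReal_mul (show 0 ≤ 100 * ((N : ℝ) + 1) ^ 2 by positivity)]
      rw [ENNReal.tsum_mul_right, ENNReal.tsum_mul_left, ← weightSum,
        show 100 * ((N : ℝ) + 1) ^ 2 = 400 * (((N : ℝ) + 1) / 2) ^ 2 by ring,
        ENNReal.ofReal_mul (by norm_num), ENNReal.ofReal_ofNat]
  have h2 := hlow.trans ((lintegral_sum_mul_expSum_le hu hN3 hs a).trans (mul_le_mul_right hup 3))
  rw [← ENNReal.mul_le_mul_iff_right hq0 ENNReal.ofReal_ne_top]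
  refine h2.trans (le_of_eq ?_)
  ring

/-- The mean oscillation is controlled by the square seminorm. -/
theorem exists_oscSup_le {r : ℝ} (hr : 0 ≤ r) :
    ∃ C : ℝ≥0∞, C ≠ ∞ ∧ ∀ u : UnitAddCircle → ℂ, MemLp u 2 →
      oscSup r u ≤ C * squareSupClosed r u := by
  obtain ⟨A, hA⟩ := exists_rho_le hr
  have hσ := (weightSum_lt_top (show (1 : ℝ) < 2 by norm_num)).ne
  set K : ℝ≥0∞ := ENNReal.ofReal (72 * Real.pi * A) * (135 * weightSum 2) with hK
  set D : ℝ≥0∞ := 4 * (4 * (1200 * weightSum 2) + 4 * K ^ 2) with hD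
  -- The added `1` keeps the constant visibly nonzero, so the bound is trivial when the square
  -- supremum is infinite.
  refine ⟨D + 1, by finiteness, fun u hu => ?_⟩
  have hi := integrable_of_memLp_two hu
  by_cases hX : squareSupClosed r u = ∞
  · rw [hX, ENNReal.mul_top (by simp)]; exact le_top
  refine le_trans ?_ (mul_le_mul_left (le_self_add (b := 1)) _)
  refine iSup₂_le fun a ℓ => iSup_le fun ⟨h0, h1⟩ => ?_
  change (arcWeight r ℓ)⁻¹ * _ ≤ _
  rw [ENNReal.inv_mul_le_iff (arcWeight_ne_zero h0) (arcWeight_ne_top r ℓ)]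
  have hex : ∃ n : ℕ, ℓ⁻¹ ≤ (2 : ℝ) ^ n := by
    obtain ⟨n, hn⟩ := pow_unbounded_of_one_lt ℓ⁻¹ (one_lt_two : (1 : ℝ) < 2)
    exact ⟨n, hn.le⟩
  classical
  set k := Nat.find hex
  have hk : ℓ⁻¹ ≤ (2 : ℝ) ^ k := Nat.find_spec hex
  have hk' : ∀ n < k, 2 ^ n * ℓ ≤ 1 := fun n hn => by
    have := (not_le.1 (Nat.find_min hex hn)).le
    rwa [← one_div, le_div_iff₀ h0] at this
  set P : UnitAddCircle → ℂ := fun x => ∑ n ∈ Finset.range k, lpProj n u x with hP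
  have hPc : Continuous P := continuous_finsetSum _ fun n _ => continuous_lpProj hi n
  refine (setLIntegral_sub_setAverage_le h0 h1 hu (P a)).trans ?_
  have hlow : ∫⁻ x in arc a ℓ, ‖P x - P a‖ₑ ^ 2 ≤
      K ^ 2 * (arcWeight r ℓ * squareSupClosed r u) := by
    calc _ ≤ ∫⁻ x in arc a ℓ,
          (K * (ENNReal.ofReal (rho r ℓ) * squareSupClosed r u ^ (1 / 2 : ℝ))) ^ 2 :=
          setLIntegral_mono' (measurableSet_arc a h1) fun x hx =>
            pow_le_pow_left' (enorm_low_sub_le hA hi hX a h0 hk' hx) 2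
      _ = _ := by
        rw [lintegral_const, Measure.restrict_apply_univ, volume_arc a h1, mul_pow K,
          mul_pow (ENNReal.ofReal (rho r ℓ)), enorm_sq_rpow_half, arcWeight_eq h0]
        ring
  -- The function is split as remainder plus high part `Q` plus low part `P`. The bound on `Q` is
  -- uniform in `M`, so the remainder disappears in the limit.
  have hM : ∀ M ≥ k, ∫⁻ x in arc a ℓ, ‖u x - P a‖ₑ ^ 2 ≤
      2 * (∫⁻ x, ‖u x - ∑ n ∈ Finset.range (M + 1), lpProj n u x‖ₑ ^ 2) +
        (4 * (1200 * weightSum 2) + 4 * K ^ 2) * (arcWeight r ℓ * squareSupClosed r u) :=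
    fun M hMk => by
      set Q : UnitAddCircle → ℂ := fun x => ∑ n ∈ Finset.Ico k (M + 1), lpProj n u x with hQ
      have hQc : Continuous Q := continuous_finsetSum _ fun n _ => continuous_lpProj hi n
      have hPQ : ∀ x, ∑ n ∈ Finset.range (M + 1), lpProj n u x = P x + Q x := fun x =>
        (Finset.sum_range_add_sum_Ico _ (by lia)).symm
      simp only [hPQ]
      have e1 := setLIntegral_enorm_add_sq_le (s := arc a ℓ) (f := fun x => u x - (P x + Q x))
        (g := fun x => Q x + (P x - P a))
        (hu.aestronglyMeasurable.sub (hPc.add hQc).aestronglyMeasurable).aemeasurable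
      have e2 := setLIntegral_enorm_add_sq_le (s := arc a ℓ) (f := Q)
        (g := fun x => P x - P a) hQc.measurable.aemeasurable
      have e3 : ∀ x, u x - (P x + Q x) + (Q x + (P x - P a)) = u x - P a := fun x => by ring
      simp only [e3] at e1
      have e4 := lintegral_high_le r hi a h0 h1 hk (s := Finset.Ico k (M + 1))
        fun n hn => (Finset.mem_Ico.1 hn).1
      refine e1.trans ?_
      rw [add_mul]
      refine add_le_add (mul_le_mul_right (setLIntegral_le_lintegral _ _) 2) ?_
      refine (mul_le_mul_right (e2.trans (add_le_add (mul_le_mul_right e4 2)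
        (mul_le_mul_right hlow 2))) 2).trans (le_of_eq ?_)
      ring
  have ht := ((ENNReal.Tendsto.const_mul (tendsto_lintegral_sub_sum_lpProj hu)
    (Or.inr ENNReal.ofNat_ne_top) (a := 2)).add_const
    ((4 * (1200 * weightSum 2) + 4 * K ^ 2) * (arcWeight r ℓ * squareSupClosed r u)))
  rw [mul_zero, zero_add] at ht
  have hfin := ge_of_tendsto ht ((eventually_ge_atTop k).mono hM)
  refine (mul_le_mul_right hfin 4).trans (le_of_eq ?_)
  rw [hD]; ring

/-! ### Strict and non-strict frequency cut-offs -/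

theorem squareSup_le_squareSupClosed (r : ℝ) (u : UnitAddCircle → ℂ) :
    squareSup r u ≤ squareSupClosed r u := by
  refine iSup₂_mono fun a ℓ => iSup_mono fun _ => ?_
  refine mul_le_mul_right (lintegral_mono fun x => ?_) _
  exact ENNReal.tsum_comp_le_tsum_of_injective
    (f := fun n : {n : ℕ // ℓ⁻¹ < (2 : ℝ) ^ n} =>
      (⟨n.1, n.2.le⟩ : {n : ℕ // ℓ⁻¹ ≤ (2 : ℝ) ^ n}))
    (fun _ _ h => Subtype.ext (Subtype.mk.inj h)) fun n => ‖lpProj n u x‖ₑ ^ 2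

theorem lintegral_squareOpen_le (r : ℝ) (u : UnitAddCircle → ℂ) (a : ℝ) {ℓ : ℝ} (h0 : 0 < ℓ)
    (h1 : ℓ ≤ 1) :
    ∫⁻ x in arc a ℓ, ∑' n : {n : ℕ // ℓ⁻¹ < (2 : ℝ) ^ n}, ‖lpProj n u x‖ₑ ^ 2 ≤
      arcWeight r ℓ * squareSup r u := by
  rw [← ENNReal.inv_mul_le_iff (arcWeight_ne_zero h0) (arcWeight_ne_top r ℓ)]
  exact le_iSup₂_of_le a ℓ (le_iSup_of_le ⟨h0, h1⟩ le_rfl)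

/-- The strict sum never contains `Δ_0`, so the `L²` norm is added to pay for it. That suffices for
finiteness in part (a). -/
theorem exists_squareSupClosed_le_squareSup {r : ℝ} (hr : 0 ≤ r) :
    ∃ C : ℝ≥0∞, C ≠ ∞ ∧ ∀ u : UnitAddCircle → ℂ, MemLp u 2 →
      squareSupClosed r u ≤ C * (squareSup r u + ∫⁻ x, ‖u x‖ₑ ^ 2) := by
  obtain ⟨A, hA⟩ := exists_rho_le hr
  have hw0 := arcWeight_ne_zero (r := r) one_pos
  set B : ℝ≥0∞ := ENNReal.ofReal (A ^ 2 * 2 ^ (3 / 2 : ℝ)) with hB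
  refine ⟨B + (arcWeight r 1)⁻¹, by finiteness, fun u hu => ?_⟩
  have hi := integrable_of_memLp_two hu
  refine iSup₂_le fun a ℓ => iSup_le fun ⟨h0, h1⟩ => ?_
  change (arcWeight r ℓ)⁻¹ * _ ≤ _
  rw [ENNReal.inv_mul_le_iff (arcWeight_ne_zero h0) (arcWeight_ne_top r ℓ)]
  rw [lintegral_congr fun x => tsum_high_eq ℓ h0 fun n => ‖lpProj n u x‖ₑ ^ 2]
  have hm : Measurable fun x => if 1 ≤ ℓ then ‖lpProj 0 u x‖ₑ ^ 2 else 0 := by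
    split_ifs
    · exact ((continuous_lpProj hi 0).enorm.measurable).pow_const 2
    · exact measurable_const
  rw [lintegral_add_left hm]
  have hzero : ∫⁻ x in arc a ℓ, (if 1 ≤ ℓ then ‖lpProj 0 u x‖ₑ ^ 2 else 0) ≤
      arcWeight r ℓ * ((arcWeight r 1)⁻¹ * ∫⁻ x, ‖u x‖ₑ ^ 2) := by
    split_ifs with h
    · obtain rfl : ℓ = 1 := le_antisymm h1 h
      rw [← mul_assoc, ENNReal.mul_inv_cancel hw0 (arcWeight_ne_top r 1), one_mul]
      exact (setLIntegral_le_lintegral _ _).trans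
        ((ENNReal.le_tsum (f := fun n => ∫⁻ x, ‖lpProj n u x‖ₑ ^ 2) 0).trans
          (tsum_lintegral_lpProj_le hu))
    · simp
  -- Doubling the arc makes `2^{n+1} ≥ ℓ⁻¹` strict. When the length is capped at `1`, strictness
  -- comes from the index being at least `1`.
  set m : ℝ := min 1 (2 * ℓ) with hmdef
  have hm0 : 0 < m := lt_min one_pos (by positivity)
  have hm1 : m ≤ 1 := min_le_left _ _
  have hℓm : ℓ ≤ m := le_min h1 (by linarith)
  have hmq : m / ℓ ≤ 2 := (div_le_iff₀ h0).2 (min_le_right _ _)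
  have hlt : ∀ n : ℕ, ℓ⁻¹ ≤ (2 : ℝ) ^ (n + 1) → m⁻¹ < (2 : ℝ) ^ (n + 1) := fun n hn => by
    rw [inv_lt_iff_one_lt_mul₀ hm0, hmdef]
    rw [inv_le_iff_one_le_mul₀ h0] at hn
    rcases min_choice 1 (2 * ℓ) with h | h
    · rw [h, mul_one]
      exact one_lt_pow₀ (by norm_num) n.succ_ne_zero
    · rw [h]; linarith
  have htail : ∫⁻ x in arc a ℓ, ∑' n : ℕ,
      (if ℓ⁻¹ ≤ (2 : ℝ) ^ (n + 1) then ‖lpProj (n + 1) u x‖ₑ ^ 2 else 0) ≤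
      arcWeight r ℓ * (B * squareSup r u) := by
    calc _ ≤ ∫⁻ x in arc a ℓ, ∑' n : {n : ℕ // m⁻¹ < (2 : ℝ) ^ n}, ‖lpProj n u x‖ₑ ^ 2 := by
          refine lintegral_mono fun x => ?_
          change _ ≤ ∑' n : {n : ℕ | m⁻¹ < (2 : ℝ) ^ n}, ‖lpProj n u x‖ₑ ^ 2
          rw [tsum_subtype {n : ℕ | m⁻¹ < (2 : ℝ) ^ n} fun n => ‖lpProj n u x‖ₑ ^ 2]
          refine le_trans (ENNReal.tsum_le_tsum fun n => ?_)
            (ENNReal.tsum_comp_le_tsum_of_injective Nat.succ_injective _)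
          split_ifs with h
          · have hn : n.succ ∈ {n : ℕ | m⁻¹ < (2 : ℝ) ^ n} := hlt n h
            rw [Set.indicator_of_mem hn]
          · exact zero_le
      _ ≤ ∫⁻ x in arc a m, ∑' n : {n : ℕ // m⁻¹ < (2 : ℝ) ^ n}, ‖lpProj n u x‖ₑ ^ 2 :=
          lintegral_mono_set (arc_subset_arc le_rfl (by linarith))
      _ ≤ arcWeight r m * squareSup r u := lintegral_squareOpen_le r u a hm0 hm1
      _ ≤ B * arcWeight r ℓ * squareSup r u := by
          gcongr
          exact arcWeight_le hA h0 hℓm hmq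
      _ = _ := by ring
  refine (add_le_add hzero htail).trans ?_
  rw [← mul_add, mul_add (B + _), add_comm]
  refine mul_le_mul_right (add_le_add ?_ ?_) _
  · exact mul_le_mul_left le_self_add _
  · exact mul_le_mul_left le_add_self _

theorem lintegral_enorm_sq_lt_top {u : UnitAddCircle → ℂ} (hu : MemLp u 2) :
    ∫⁻ x, ‖u x‖ₑ ^ 2 < ∞ := by
  have := (eLpNorm_lt_top_iff_lintegral_rpow_enorm_lt_top (by norm_num) (by norm_num)).1 hu.2
  simpa using this

end LPBMO

end

/-! ### Assembly of both parts -/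

theorem mainTheorem5 (r : ℝ) (hr : 0 ≤ r) :
    (∀ u : UnitAddCircle → ℂ, MemLp u 2 (volume : Measure UnitAddCircle) →
      (LPBMO.MemBMO r u ↔ LPBMO.squareSup r u < ∞)) ∧
    ∃ C : ℝ≥0, 0 < C ∧
      ∀ u : UnitAddCircle → ℂ, MemLp u 2 (volume : Measure UnitAddCircle) →
        LPBMO.bmoPlusNorm r u ≤ C * (‖∫ x, u x‖ₑ + LPBMO.squareSeminorm r u) ∧
        ‖∫ x, u x‖ₑ + LPBMO.squareSeminorm r u ≤ C * LPBMO.bmoPlusNorm r u := by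
  obtain ⟨C₁, hC₁, h₁⟩ := LPBMO.exists_squareSupClosed_le hr
  obtain ⟨C₂, hC₂, h₂⟩ := LPBMO.exists_oscSup_le hr
  obtain ⟨C₃, hC₃, h₃⟩ := LPBMO.exists_squareSupClosed_le_squareSup hr
  refine ⟨fun u hu => ⟨fun h => ?_, fun h => ⟨hu, ?_⟩⟩, ?_⟩
  · have hO := h.2.ne
    refine (LPBMO.squareSup_le_squareSupClosed r u).trans_lt ((h₁ u hu).trans_lt ?_)
    finiteness
  · have h4 := (LPBMO.lintegral_enorm_sq_lt_top hu).ne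
    refine (h₂ u hu).trans_lt (ENNReal.mul_lt_top hC₂.lt_top ((h₃ u hu).trans_lt ?_))
    finiteness
  -- The comparisons are between squared quantities, so square roots of their constants enter; the
  -- `1` covers the mean, which stands on both sides.
  · set D : ℝ≥0∞ := 1 + C₁ ^ (1 / 2 : ℝ) + C₂ ^ (1 / 2 : ℝ) with hD
    have hDtop : D ≠ ∞ := by
      have := ENNReal.rpow_ne_top_of_nonneg (show (0 : ℝ) ≤ 1 / 2 by norm_num) hC₁
      have := ENNReal.rpow_ne_top_of_nonneg (show (0 : ℝ) ≤ 1 / 2 by norm_num) hC₂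
      finiteness
    have hD1 : 1 ≤ D := by rw [hD, add_assoc]; exact le_self_add
    have hDC₁ : C₁ ^ (1 / 2 : ℝ) ≤ D := by
      rw [hD, add_right_comm]; exact le_add_self
    have hDC₂ : C₂ ^ (1 / 2 : ℝ) ≤ D := le_add_self
    have hDc : ((D.toNNReal : ℝ≥0) : ℝ≥0∞) = D := ENNReal.coe_toNNReal hDtop
    refine ⟨D.toNNReal, ENNReal.toNNReal_pos (by positivity) hDtop, fun u hu => ?_⟩
    rw [hDc, LPBMO.bmoPlusNorm, LPBMO.squareSeminorm]
    have hO : LPBMO.oscSup r u ^ (1 / 2 : ℝ) ≤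
        C₂ ^ (1 / 2 : ℝ) * LPBMO.squareSupClosed r u ^ (1 / 2 : ℝ) := by
      rw [← ENNReal.mul_rpow_of_nonneg _ _ (by norm_num)]
      exact ENNReal.rpow_le_rpow (h₂ u hu) (by norm_num)
    have hS : LPBMO.squareSupClosed r u ^ (1 / 2 : ℝ) ≤
        C₁ ^ (1 / 2 : ℝ) * (LPBMO.oscSup r u ^ (1 / 2 : ℝ) + ‖∫ x, u x‖ₑ) := by
      refine (ENNReal.rpow_le_rpow (h₁ u hu) (by norm_num)).trans ?_
      rw [ENNReal.mul_rpow_of_nonneg _ _ (by norm_num)]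
      refine mul_le_mul_right ((ENNReal.rpow_add_le_add_rpow _ _ (by norm_num)
        (by norm_num)).trans (le_of_eq ?_)) _
      congr 1
      rw [← ENNReal.rpow_natCast, ← ENNReal.rpow_mul]; norm_num
    constructor
    · rw [mul_add]
      exact add_le_add (le_mul_of_one_le_left zero_le hD1) (hO.trans (mul_le_mul_left hDC₂ _))
    · calc _ ≤ ‖∫ x, u x‖ₑ +
            C₁ ^ (1 / 2 : ℝ) * (LPBMO.oscSup r u ^ (1 / 2 : ℝ) + ‖∫ x, u x‖ₑ) :=
            add_le_add le_rfl hS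
        _ = (1 + C₁ ^ (1 / 2 : ℝ)) * ‖∫ x, u x‖ₑ +
            C₁ ^ (1 / 2 : ℝ) * LPBMO.oscSup r u ^ (1 / 2 : ℝ) := by ring
        _ ≤ D * ‖∫ x, u x‖ₑ + D * LPBMO.oscSup r u ^ (1 / 2 : ℝ) :=
            add_le_add (mul_le_mul_left le_self_add _) (mul_le_mul_left hDC₁ _)
        _ = _ := (mul_add _ _ _).symm
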